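/- Let $d\ge 2$, let $\mathcal I=\{1,\dots,2d\}$ with $\bar i=i+d \bmod 2d$, and fix Schottky data: open discs $D_i\subset\mathbb C$ $(i\in\mathcal I)$ with centres on $\mathbb R$ and pairwise disjoint closures, and matrices $\gamma_i\in\mathrm{SL}_2(\mathbb R)$ with $\gamma_{\bar i}=\gamma_i^{-1}$ whose Möbius action satisfies $\gamma_i(\hat{\mathbb C}\setminus D_{\bar i})=\overline{D_i}$. Put $\mathbf D=\bigcup_i D_i$, let $T:\mathbf D\to\hat{\mathbb C}$ be the map equal to $\gamma_i^{-1}$ on $D_i$, and let $\delta$ be the Hausdorff dimension of the limit set $\bigcap_{n\ge1}T^{-n}(\mathbf D)$. Let $\tau$ be the analytic continuation of $\log|T'|$ from the real line to the discs $\gamma_i(D_j)$, $j\ne\bar i$. Let $\mathcal H(\mathbf D)$ be the Bergman space of square integrable holomorphic functions on $\mathbf D$, and for $s\in\mathbb C$ let $A_i(s)$ be the bounded operator on $\mathcal H(\mathbf D)$ given by $A_i(s)[f](x)=\mathbf 1\{x\notin D_i\}\,e^{-s\tau(\gamma_{\bar i}(x))}f(\gamma_{\bar i}(x))$. For $n\in\mathbb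 N$ let $\sigma_1,\dots,\sigma_d$ be independent uniformly random permutations of $[n]$, let $\sigma_{\bar i}=\sigma_i^{-1}$, $(S_i)_{xy}=\mathbf 1\{\sigma_i(x)=y\}$ and $(\underline S_i)_{xy}=(S_i)_{xy}-\frac1n$. A path of length $m$ is a sequence $\gamma=((x_1,i_1),\dots,(x_m,i_m))$ in $[n]\times\mathcal I$; it is non-backtracking if $i_t\ne\overline{i_{t+1}}$ for $1\le t<m$. Its graph is the multigraph with vertices $x_1,\dots,x_m$ and edges the classes $[x_t,i_t,x_{t+1}]$, $1\le t<m$, for the equivalence relation generated by $(x,i,y)\sim(y,\bar i,x)$; the path is tangle-free if this multigraph contains at most one cycle (loops and pairs of parallel edges being cycles of length one and two). Let $F^{m}$ be the set of non-backtracking tangle-free paths of length $m$, and for $1\le k\le\ell$ let $F^{\ell+1}_k$ be the set of non-backtracking paths of length $\ell+1$ whose first $k$ terms and whose last $\ell-k+1$ terms both form tangle-free paths. For $e=(x,i)$ let $\mathfrak p_e$ be the orthogonal projection of $\mathcal H(\mathbf D)\otimes\ell^2([n])$ onto $\mathcal H(D_{\bar i})\otimes\mathbb Cx$, let $\mathcal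 E_{xy}$ be the operator on $\ell^2([n])$ with $\mathcal E_{xy}y'=\delta_{yy'}x$, and define on $\mathcal H(\mathbf D)\otimes\ell^2([n])$ the operator $$R_k(s)^{(\ell)}=\sum_{\gamma\in F^{\ell+1}_k\setminus F^{\ell+1}}\mathfrak p_{(x_1,i_1)}\big[A_{i_2}(s)\cdots A_{i_{\ell+1}}(s)\otimes\mathcal E_{x_1x_{\ell+1}}\big]\mathfrak p_{(x_{\ell+1},i_{\ell+1})}\prod_{t=1}^{k-1}(\underline S_{i_t})_{x_tx_{t+1}}\prod_{t=k+1}^{\ell}(S_{i_t})_{x_tx_{t+1}},$$ where $\gamma=((x_1,i_1),\dots,(x_{\ell+1},i_{\ell+1}))$. **Proposition.** Let $\mathcal K$ be a compact subset of $\{s\in\mathbb C:\mathrm{Re}(s)>\delta/2\}$. There are constants $c>0$ and $\rho_1>1$, depending only on $\mathcal K$ and the Schottky data, such that for every $s\in\mathcal K$ and all integers $n,k,\ell$ with $1\le k\le\ell\le\log n$, the event $$\|R_k(s)^{(\ell)}\|\le(\log n)^{40}\rho_1^{\ell}$$ (operator norm) holds with probability at least $1-c\exp\left(-\frac{\ell\log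 n}{c\log\log n}\right)$. -/

import Mathlib

namespace Schottky

open Metric MeasureTheory

/-- The alphabet with `2d` letters: `(i, false)` stands for the letter `i` and `(i, true)` for
`i + d`, where `i = 1, …, d`. -/
abbrev Color (d : ℕ) : Type := Fin d × Bool

/-- The involution `i ↦ ī = i + d mod 2d` of the alphabet. -/
def bar {d : ℕ} (i : Color d) : Color d := (i.1, !i.2)

/-- The Möbius action of `SL₂(ℝ)` on the extended complex plane. -/
noncomputable def act (g : Matrix.SpecialLinearGroup (Fin 2) ℝ) (z : OnePoint ℂ) : OnePoint ℂ :=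
  Matrix.SpecialLinearGroup.mapGL ℂ g • z

/-- The Möbius map as a function on `ℂ` (meaningful away from the pole of `g`). -/
noncomputable def mob (g : Matrix.SpecialLinearGroup (Fin 2) ℝ) (z : ℂ) : ℂ :=
  ((g 0 0 : ℝ) * z + (g 0 1 : ℝ)) / ((g 1 0 : ℝ) * z + (g 1 1 : ℝ))

/-- Schottky data: `2d` open discs `D_i` centred on the real line with pairwise disjoint closures,
and `γ_i ∈ SL₂(ℝ)` with `γ_ī = γ_i⁻¹` and `γ_i (Ĉ ∖ D_ī) = closure D_i`. -/
structure SchottkyData (d : ℕ) where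
  center : Color d → ℝ
  radius : Color d → ℝ
  radius_pos : ∀ i, 0 < radius i
  disjoint_closures : ∀ i j, i ≠ j →
    Disjoint (closedBall (center i : ℂ) (radius i)) (closedBall (center j : ℂ) (radius j))
  gen : Color d → Matrix.SpecialLinearGroup (Fin 2) ℝ
  gen_bar : ∀ i, gen (bar i) = (gen i)⁻¹
  mapping : ∀ i,
    act (gen i) '' ((fun z : ℂ => (z : OnePoint ℂ)) '' ball (center (bar i) : ℂ) (radius (bar i)))ᶜ
      = (fun z : ℂ => (z : OnePoint ℂ)) '' closedBall (center i : ℂ) (radius i)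

variable {d : ℕ} (S : SchottkyData d)

/-- The open disc `D_i`. -/
def SchottkyData.disc (i : Color d) : Set ℂ := ball (S.center i : ℂ) (S.radius i)

/-- The union `𝐃` of the discs. -/
def SchottkyData.discs : Set ℂ := ⋃ i, S.disc i

/-- `S.iter n` is `T⁻ⁿ(𝐃)` for the Bowen-Series map `T : 𝐃 → Ĉ`, `T = γ_i⁻¹` on `D_i`. -/
def SchottkyData.iter (S : SchottkyData d) : ℕ → Set ℂ
  | 0 => S.discs
  | n + 1 => {z | ∃ i, z ∈ S.disc i ∧
      ∃ w ∈ SchottkyData.iter S n, act (S.gen i)⁻¹ (z : OnePoint ℂ) = (w : OnePoint ℂ)}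

/-- The limit set `K(Λ) = ⋂_{n ≥ 1} T⁻ⁿ(𝐃)`. -/
def SchottkyData.limitSet : Set ℂ := ⋂ n ∈ Set.Ici 1, S.iter n

/-- `δ(Λ)`, the Hausdorff dimension of the limit set. -/
noncomputable def SchottkyData.delta : ℝ := (dimH S.limitSet).toReal

/-- The complex derivative `T'` of the Bowen-Series map on `𝐃` (and `0` off `𝐃`). -/
noncomputable def SchottkyData.bowenDeriv (z : ℂ) : ℂ :=
  ∑ i, (S.disc i).indicator (deriv (mob (S.gen i)⁻¹)) z

/-- `τ`, the analytic continuation of `log |T'|` from the real line. On each disc `γ_i(D_j)`, `i → j`,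
the function `T'` takes values in `ℂ ∖ (-∞, 0]` and is positive on the real line, so that the
continuation is given by the principal logarithm. -/
noncomputable def SchottkyData.tau (z : ℂ) : ℂ := Complex.log (S.bowenDeriv z)

theorem bar_bar (i : Color d) : bar (bar i) = i := by simp [bar]

theorem act_coe (g : Matrix.SpecialLinearGroup (Fin 2) ℝ) (z : ℂ) :
    act g (z : OnePoint ℂ) = if ((g 1 0 : ℝ) : ℂ) * z + (g 1 1 : ℝ) = 0 then OnePoint.infty
      else ((mob g z : ℂ) : OnePoint ℂ) := by
  simp [act, mob, OnePoint.smul_some_eq_ite]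

theorem act_act (g h : Matrix.SpecialLinearGroup (Fin 2) ℝ) (z : OnePoint ℂ) :
    act g (act h z) = act (g * h) z := by
  simp [act, mul_smul]

theorem inv_entries (g : Matrix.SpecialLinearGroup (Fin 2) ℝ) :
    g⁻¹ 0 0 = g 1 1 ∧ g⁻¹ 0 1 = - g 0 1 ∧ g⁻¹ 1 0 = - g 1 0 ∧ g⁻¹ 1 1 = g 0 0 := by
  rw [Matrix.SpecialLinearGroup.SL2_inv_expl]
  simp

theorem det_entries (g : Matrix.SpecialLinearGroup (Fin 2) ℝ) :
    ((g 0 0 : ℝ) : ℂ) * (g 1 1 : ℝ) - (g 0 1 : ℝ) * (g 1 0 : ℝ) = 1 := by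
  have h := g.det_coe
  rw [Matrix.det_fin_two] at h
  exact_mod_cast h

/-- The denominator `c x + d'` of `γ_ī`. -/
noncomputable def SchottkyData.den (i : Color d) (x : ℂ) : ℂ :=
  ((S.gen (bar i) 1 0 : ℝ) : ℂ) * x + (S.gen (bar i) 1 1 : ℝ)

theorem SchottkyData.act_mem {i j : Color d} (hij : j ≠ i) {x : ℂ}
    (hx : x ∈ closedBall (S.center j : ℂ) (S.radius j)) :
    S.den i x ≠ 0 ∧ mob (S.gen (bar i)) x ∈ S.disc (bar i) := by
  have hxi : x ∉ closedBall (S.center i : ℂ) (S.radius i) := fun h =>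
    (Set.disjoint_left.1 (S.disjoint_closures j i hij) hx) h
  have h1 : act (S.gen (bar i)) (x : OnePoint ℂ) ∈
      (fun z : ℂ => (z : OnePoint ℂ)) '' closedBall (S.center (bar i) : ℂ) (S.radius (bar i)) := by
    rw [← S.mapping (bar i), bar_bar]
    refine ⟨(x : OnePoint ℂ), ?_, rfl⟩
    rintro ⟨y, hy, hyx⟩
    rw [OnePoint.coe_eq_coe] at hyx
    exact hxi (hyx ▸ ball_subset_closedBall hy)
  obtain ⟨w, -, hw'⟩ := h1
  have hden : S.den i x ≠ 0 := by
    intro h0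
    rw [act_coe] at hw'
    exact OnePoint.coe_ne_infty _ (hw'.trans (if_pos h0))
  refine ⟨hden, ?_⟩
  by_contra hcon
  have hact : act (S.gen (bar i)) (x : OnePoint ℂ) = ((mob (S.gen (bar i)) x : ℂ) : OnePoint ℂ) := by
    rw [act_coe]
    exact if_neg hden
  have h2 : act (S.gen i) ((mob (S.gen (bar i)) x : ℂ) : OnePoint ℂ) = (x : OnePoint ℂ) := by
    rw [← hact, act_act, S.gen_bar, mul_inv_cancel]
    simp [act]
  have h3 : (x : OnePoint ℂ) ∈
      (fun z : ℂ => (z : OnePoint ℂ)) '' closedBall (S.center i : ℂ) (S.radius i) := by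
    rw [← S.mapping i, ← h2]
    refine ⟨_, ?_, rfl⟩
    rintro ⟨y, hy, hyx⟩
    rw [OnePoint.coe_eq_coe] at hyx
    exact hcon (hyx ▸ hy)
  obtain ⟨y, hy, hyx⟩ := h3
  rw [OnePoint.coe_eq_coe] at hyx
  exact hxi (hyx ▸ hy)

theorem SchottkyData.den_sq_mem {i j : Color d} (hij : j ≠ i) {x : ℂ}
    (hx : x ∈ closedBall (S.center j : ℂ) (S.radius j)) :
    S.den i x ^ 2 ∈ Complex.slitPlane := by
  have hre : ((x.re : ℝ) : ℂ) ∈ closedBall (S.center j : ℂ) (S.radius j) := by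
    rw [mem_closedBall, Complex.dist_eq] at hx ⊢
    refine le_trans ?_ hx
    have := Complex.abs_re_le_norm (x - S.center j)
    rw [← Complex.ofReal_sub, Complex.norm_real, Real.norm_eq_abs]
    simpa using this
  have h := (S.act_mem hij hre).1
  have h' : (S.den i x).re ≠ 0 := by
    intro h0
    apply h
    simp only [SchottkyData.den, Complex.add_re, Complex.mul_re, Complex.ofReal_re,
      Complex.ofReal_im, zero_mul, sub_zero] at h0
    simp only [SchottkyData.den]
    exact_mod_cast h0
  rw [Complex.mem_slitPlane_iff]
  by_cases him : (S.den i x).im = 0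
  · left
    simp [pow_two, him]
    positivity
  · right
    simp [pow_two, mul_comm, him, h']

theorem hasDerivAt_mob (g : Matrix.SpecialLinearGroup (Fin 2) ℝ) (z : ℂ)
    (hz : ((g 1 0 : ℝ) : ℂ) * z + (g 1 1 : ℝ) ≠ 0) :
    HasDerivAt (mob g) (1 / (((g 1 0 : ℝ) : ℂ) * z + (g 1 1 : ℝ)) ^ 2) z := by
  have h1 : HasDerivAt (fun z : ℂ => ((g 0 0 : ℝ) : ℂ) * z + (g 0 1 : ℝ)) (g 0 0 : ℝ) z := by
    simpa using ((hasDerivAt_id z).const_mul ((g 0 0 : ℝ) : ℂ)).add_const ((g 0 1 : ℝ) : ℂ)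
  have h2 : HasDerivAt (fun z : ℂ => ((g 1 0 : ℝ) : ℂ) * z + (g 1 1 : ℝ)) (g 1 0 : ℝ) z := by
    simpa using ((hasDerivAt_id z).const_mul ((g 1 0 : ℝ) : ℂ)).add_const ((g 1 1 : ℝ) : ℂ)
  have h3 := h1.div h2 hz
  have h4 : HasDerivAt (mob g) _ z := h3
  convert h4 using 1
  congr 1
  linear_combination - det_entries g

theorem SchottkyData.tau_mob {i j : Color d} (hij : j ≠ i) {x : ℂ}
    (hx : x ∈ closedBall (S.center j : ℂ) (S.radius j)) :
    S.tau (mob (S.gen (bar i)) x) = Complex.log (S.den i x ^ 2) := by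
  obtain ⟨hd, hm⟩ := S.act_mem hij hx
  have hb : S.bowenDeriv (mob (S.gen (bar i)) x)
      = deriv (mob (S.gen (bar i))⁻¹) (mob (S.gen (bar i)) x) := by
    rw [SchottkyData.bowenDeriv, Finset.sum_eq_single (bar i)]
    · rw [Set.indicator_of_mem hm]
    · intro b _ hb
      refine Set.indicator_of_notMem (fun hmem => ?_) _
      exact Set.disjoint_left.1 (S.disjoint_closures b (bar i) hb)
        (ball_subset_closedBall hmem) (ball_subset_closedBall hm)
    · simp
  obtain ⟨e1, e2, e3, e4⟩ := inv_entries (S.gen (bar i))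
  have key : ((((S.gen (bar i))⁻¹ 1 0 : ℝ)) : ℂ) * mob (S.gen (bar i)) x
      + (((S.gen (bar i))⁻¹ 1 1 : ℝ)) = 1 / S.den i x := by
    have hdet := det_entries (S.gen (bar i))
    rw [e3, e4, mob]
    rw [SchottkyData.den] at hd ⊢
    push_cast
    generalize ((S.gen (bar i) 0 0 : ℝ) : ℂ) = a at *
    generalize ((S.gen (bar i) 0 1 : ℝ) : ℂ) = b at *
    generalize ((S.gen (bar i) 1 0 : ℝ) : ℂ) = c at *
    generalize ((S.gen (bar i) 1 1 : ℝ) : ℂ) = e at *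
    field_simp
    linear_combination hdet
  rw [SchottkyData.tau, hb, (hasDerivAt_mob _ _ _).deriv, key]
  · congr 1
    field_simp
  · rw [key]
    exact one_div_ne_zero hd

theorem SchottkyData.isOpen_discs : IsOpen S.discs := isOpen_iUnion fun _ => isOpen_ball

theorem SchottkyData.measurableSet_discs : MeasurableSet S.discs := S.isOpen_discs.measurableSet

/-- Square integrable holomorphic functions on `𝐃`, extended by zero to `ℂ`. -/
def SchottkyData.bergmanSubmodule : Submodule ℂ (ℂ → ℂ) where
  carrier := {f | DifferentiableOn ℂ f S.discs ∧ MemLp f 2 (volume.restrict S.discs) ∧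
    ∀ z ∉ S.discs, f z = 0}
  add_mem' := fun ha hb => ⟨ha.1.add hb.1, ha.2.1.add hb.2.1,
    fun z hz => by simp [ha.2.2 z hz, hb.2.2 z hz]⟩
  zero_mem' := ⟨differentiableOn_const 0, MemLp.zero, fun _ _ => rfl⟩
  smul_mem' := fun c _ ha => ⟨ha.1.const_smul c, ha.2.1.const_smul c,
    fun z hz => by simp [ha.2.2 z hz]⟩

/-- The Bergman space `𝓗(𝐃) = 𝓗(𝐃; ℂ)`, with inner product `∫_𝐃 ⟨f, g⟩ dm`. -/
def SchottkyData.Bergman : Type := S.bergmanSubmodule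

namespace SchottkyData.Bergman

noncomputable instance : AddCommGroup S.Bergman := inferInstanceAs (AddCommGroup S.bergmanSubmodule)

noncomputable instance : Module ℂ S.Bergman := inferInstanceAs (Module ℂ S.bergmanSubmodule)

variable {S}

/-- The underlying function of an element of the Bergman space. -/
def val (f : S.Bergman) : ℂ → ℂ := Subtype.val f

theorem prop (f : S.Bergman) : DifferentiableOn ℂ f.val S.discs ∧
    MemLp f.val 2 (volume.restrict S.discs) ∧ ∀ z ∉ S.discs, f.val z = 0 := Subtype.property f

/-- The element of the Bergman space with a given underlying function. -/
def mk (f : ℂ → ℂ) (hf : f ∈ S.bergmanSubmodule) : S.Bergman := ⟨f, hf⟩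

theorem val_mk (f : ℂ → ℂ) (hf : f ∈ S.bergmanSubmodule) : (mk f hf).val = f := rfl

theorem ext_val {f g : S.Bergman} (h : f.val = g.val) : f = g := Subtype.ext h

theorem val_add (f g : S.Bergman) : (f + g).val = f.val + g.val := rfl

theorem val_smul (c : ℂ) (f : S.Bergman) : (c • f).val = c • f.val := rfl

theorem integrable_inner (f g : S.Bergman) :
    Integrable (fun z => (starRingEnd ℂ) (f.val z) * g.val z) (volume.restrict S.discs) := by
  have := f.prop.2.1.star.integrable_mul g.prop.2.1
  exact this

theorem integral_self (f : S.Bergman) :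
    ∫ z in S.discs, (starRingEnd ℂ) (f.val z) * f.val z
      = ((∫ z in S.discs, ‖f.val z‖ ^ 2 : ℝ) : ℂ) := by
  rw [← integral_complex_ofReal]
  refine integral_congr_ae (Filter.Eventually.of_forall fun z => ?_)
  change (starRingEnd ℂ) (f.val z) * f.val z = _
  rw [mul_comm, Complex.mul_conj, Complex.normSq_eq_norm_sq]

/-- The inner product of the Bergman space. -/
noncomputable abbrev core : InnerProductSpace.Core ℂ S.Bergman where
  inner f g := ∫ z in S.discs, (starRingEnd ℂ) (f.val z) * g.val z
  conj_inner_symm f g := by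
    rw [← integral_conj]
    simp [mul_comm]
  re_inner_nonneg f := by
    rw [integral_self]
    exact integral_nonneg fun z => by positivity
  add_left f g h := by
    rw [← integral_add (integrable_inner f h) (integrable_inner g h)]
    simp [val_add, add_mul]
  smul_left f g c := by
    rw [← integral_const_mul]
    simp [val_smul, mul_assoc]
  definite f hf := by
    change ∫ z in S.discs, (starRingEnd ℂ) (f.val z) * f.val z = 0 at hf
    rw [integral_self] at hf
    have hf' : ∫ z in S.discs, ‖f.val z‖ ^ 2 = 0 := by exact_mod_cast hf
    have hint := (memLp_two_iff_integrable_sq_norm f.prop.2.1.1).1 f.prop.2.1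
    rw [integral_eq_zero_iff_of_nonneg (fun z => by positivity) hint] at hf'
    have hae : f.val =ᵐ[volume.restrict S.discs] fun _ => 0 := by
      filter_upwards [hf'] with z hz
      simpa using hz
    have heq := Measure.eqOn_open_of_ae_eq hae S.isOpen_discs f.prop.1.continuousOn
      continuousOn_const
    refine ext_val (funext fun z => ?_)
    by_cases hz : z ∈ S.discs
    · exact heq hz
    · exact f.prop.2.2 z hz

noncomputable instance : NormedAddCommGroup S.Bergman :=
  @InnerProductSpace.Core.toNormedAddCommGroup ℂ S.Bergman _ _ _ core

noncomputable instance : InnerProductSpace ℂ S.Bergman := InnerProductSpace.ofCore core.toCore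

theorem inner_def (f g : S.Bergman) :
    inner ℂ f g = ∫ z in S.discs, (starRingEnd ℂ) (f.val z) * g.val z := rfl

theorem norm_sq (f : S.Bergman) : ‖f‖ ^ 2 = ∫ z in S.discs, ‖f.val z‖ ^ 2 := by
  have h := inner_self_eq_norm_sq_to_K (𝕜 := ℂ) f
  rw [inner_def, integral_self] at h
  exact Complex.ofReal_injective ((Complex.ofReal_pow _ _).trans h.symm)

/-- A bound between `L²` norms gives a bound between norms in the Bergman space. -/
theorem norm_le_of_lintegral {f g : S.Bergman} {C : ℝ} (hC : 0 ≤ C)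
    (h : ∫⁻ z in S.discs, ENNReal.ofReal (‖g.val z‖ ^ 2)
      ≤ ENNReal.ofReal (C ^ 2) * ∫⁻ z in S.discs, ENNReal.ofReal (‖f.val z‖ ^ 2)) :
    ‖g‖ ≤ C * ‖f‖ := by
  have key : ∀ u : S.Bergman,
      ∫⁻ z in S.discs, ENNReal.ofReal (‖u.val z‖ ^ 2) = ENNReal.ofReal (‖u‖ ^ 2) := fun u => by
    rw [norm_sq, ofReal_integral_eq_lintegral_ofReal
      ((memLp_two_iff_integrable_sq_norm u.prop.2.1.1).1 u.prop.2.1)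
      (Filter.Eventually.of_forall fun z => by positivity)]
  rw [key, key, ← ENNReal.ofReal_mul (by positivity), ← mul_pow,
    ENNReal.ofReal_le_ofReal_iff (by positivity)] at h
  exact le_of_sq_le_sq h (by positivity)

end SchottkyData.Bergman

/-- The function `A_i(s)[f]`, `x ↦ 1{x ∉ D_i} exp(-s τ(γ_ī x)) f(γ_ī x)` on `𝐃`. -/
noncomputable def SchottkyData.opFun (i : Color d) (s : ℂ) (f : ℂ → ℂ) : ℂ → ℂ :=
  (S.discs \ S.disc i).indicator fun x =>
    Complex.exp (-s * S.tau (mob (S.gen (bar i)) x)) * f (mob (S.gen (bar i)) x)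

theorem SchottkyData.exists_ne_of_mem {i : Color d} {x : ℂ} (hx : x ∈ S.discs \ S.disc i) :
    ∃ j, j ≠ i ∧ x ∈ S.disc j := by
  obtain ⟨j, hj⟩ := Set.mem_iUnion.1 hx.1
  exact ⟨j, fun h => hx.2 (h ▸ hj), hj⟩

theorem SchottkyData.not_mem_disc {i j : Color d} (hij : j ≠ i) {x : ℂ} (hx : x ∈ S.disc j) :
    x ∉ S.disc i := fun h => Set.disjoint_left.1 (S.disjoint_closures j i hij)
      (ball_subset_closedBall hx) (ball_subset_closedBall h)

theorem SchottkyData.differentiableOn_opFun (i : Color d) (s : ℂ) {f : ℂ → ℂ}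
    (hf : DifferentiableOn ℂ f S.discs) : DifferentiableOn ℂ (S.opFun i s f) S.discs := by
  intro x hx
  obtain ⟨j, hj⟩ := Set.mem_iUnion.1 hx
  have hnhds : S.disc j ∈ nhds x := isOpen_ball.mem_nhds hj
  refine DifferentiableAt.differentiableWithinAt ?_
  by_cases hij : j = i
  · refine (differentiableAt_const (0 : ℂ)).congr_of_eventuallyEq ?_
    filter_upwards [hnhds] with y hy
    exact Set.indicator_of_notMem (fun h => h.2 (hij ▸ hy)) _
  · have hloc : S.opFun i s f =ᶠ[nhds x] fun y =>
        Complex.exp (-s * Complex.log (S.den i y ^ 2)) * f (mob (S.gen (bar i)) y) := by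
      filter_upwards [hnhds] with y hy
      have hy' : y ∈ S.discs \ S.disc i :=
        ⟨Set.mem_iUnion.2 ⟨j, hy⟩, S.not_mem_disc hij hy⟩
      rw [SchottkyData.opFun, Set.indicator_of_mem hy',
        S.tau_mob hij (ball_subset_closedBall hy)]
    refine DifferentiableAt.congr_of_eventuallyEq ?_ hloc
    have hxc := ball_subset_closedBall hj
    have hden : DifferentiableAt ℂ (S.den i) x := by
      unfold SchottkyData.den
      fun_prop
    have hlog : DifferentiableAt ℂ (fun y => Complex.log (S.den i y ^ 2)) x :=
      (hden.pow 2).clog (S.den_sq_mem hij hxc)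
    obtain ⟨hd, hm⟩ := S.act_mem hij hxc
    have hmob := (hasDerivAt_mob (S.gen (bar i)) x hd).differentiableAt
    have hfm : DifferentiableAt ℂ f (mob (S.gen (bar i)) x) :=
      hf.differentiableAt (S.isOpen_discs.mem_nhds (Set.mem_iUnion.2 ⟨_, hm⟩))
    exact ((hlog.const_mul (-s)).cexp).mul (hfm.comp x hmob)

theorem SchottkyData.exists_weight_bound (i : Color d) (s : ℂ) :
    ∃ M : ℝ, 0 ≤ M ∧ ∀ x ∈ S.discs \ S.disc i,
      ‖Complex.exp (-s * S.tau (mob (S.gen (bar i)) x))‖ ≤ M * ‖1 / S.den i x ^ 2‖ := by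
  have hj : ∀ j : Color d, ∃ M : ℝ, j ≠ i → ∀ x ∈ S.disc j,
      ‖Complex.exp (-s * S.tau (mob (S.gen (bar i)) x))‖ ≤ M * ‖1 / S.den i x ^ 2‖ := by
    intro j
    by_cases hij : j = i
    · exact ⟨0, fun h => absurd hij h⟩
    have hcont : ContinuousOn (fun y => Complex.exp (-s * Complex.log (S.den i y ^ 2))
        * S.den i y ^ 2) (closedBall (S.center j : ℂ) (S.radius j)) := by
      intro y hy
      have hden : ContinuousAt (S.den i) y := by
        unfold SchottkyData.den
        fun_prop
      have hlog : ContinuousAt (fun y => Complex.log (S.den i y ^ 2)) y :=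
        (hden.pow 2).clog (S.den_sq_mem hij hy)
      exact (((continuousAt_const.mul hlog).cexp).mul (hden.pow 2)).continuousWithinAt
    obtain ⟨M, hM⟩ := 
      (isCompact_closedBall (S.center j : ℂ) (S.radius j)).exists_bound_of_continuousOn hcont
    refine ⟨M, fun _ x hx => ?_⟩
    have hxc := ball_subset_closedBall hx
    have h := hM x hxc
    have hd := (S.act_mem hij hxc).1
    have hpos : 0 < ‖S.den i x ^ 2‖ := norm_pos_iff.2 (pow_ne_zero 2 hd)
    rw [S.tau_mob hij hxc, norm_div, norm_one, mul_one_div, le_div_iff₀ hpos]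
    rwa [norm_mul] at h
  choose M hM using hj
  refine ⟨∑ j, |M j|, by positivity, fun x hx => ?_⟩
  obtain ⟨j, hji, hxj⟩ := S.exists_ne_of_mem hx
  refine (hM j hji x hxj).trans (mul_le_mul_of_nonneg_right ?_ (norm_nonneg _))
  exact (le_abs_self _).trans
    (Finset.single_le_sum (f := fun j => |M j|) (fun _ _ => abs_nonneg _) (Finset.mem_univ j))

theorem SchottkyData.injOn_mob (i : Color d) :
    Set.InjOn (mob (S.gen (bar i))) (S.discs \ S.disc i) := by
  intro x hx y hy hxy
  obtain ⟨j, hji, hxj⟩ := S.exists_ne_of_mem hx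
  obtain ⟨k, hki, hyk⟩ := S.exists_ne_of_mem hy
  have h1 := (S.act_mem hji (ball_subset_closedBall hxj)).1
  have h2 := (S.act_mem hki (ball_subset_closedBall hyk)).1
  have hact : act (S.gen (bar i)) (x : OnePoint ℂ) = act (S.gen (bar i)) (y : OnePoint ℂ) := by
    rw [act_coe, act_coe]
    refine (if_neg h1).trans (Eq.trans ?_ (if_neg h2).symm)
    rw [hxy]
  have h3 : (x : OnePoint ℂ) = (y : OnePoint ℂ) := MulAction.injective _ hact
  exact OnePoint.coe_eq_coe.1 h3

theorem SchottkyData.lintegral_opFun_le (i : Color d) (s : ℂ) {M : ℝ}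
    (hM : ∀ x ∈ S.discs \ S.disc i,
      ‖Complex.exp (-s * S.tau (mob (S.gen (bar i)) x))‖ ≤ M * ‖1 / S.den i x ^ 2‖) (f : ℂ → ℂ) :
    ∫⁻ z in S.discs, ENNReal.ofReal (‖S.opFun i s f z‖ ^ 2)
      ≤ ENNReal.ofReal (M ^ 2) * ∫⁻ z in S.discs, ENNReal.ofReal (‖f z‖ ^ 2) := by
  have hmeas : MeasurableSet (S.discs \ S.disc i) :=
    S.measurableSet_discs.diff measurableSet_ball
  have hsub : mob (S.gen (bar i)) '' (S.discs \ S.disc i) ⊆ S.discs := by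
    rintro _ ⟨x, hx, rfl⟩
    obtain ⟨j, hji, hxj⟩ := S.exists_ne_of_mem hx
    exact Set.mem_iUnion.2 ⟨_, (S.act_mem hji (ball_subset_closedBall hxj)).2⟩
  have hder : ∀ x ∈ S.discs \ S.disc i, HasFDerivWithinAt (mob (S.gen (bar i)))
      ((ContinuousLinearMap.toSpanSingleton ℂ (1 / S.den i x ^ 2)).restrictScalars ℝ)
      (S.discs \ S.disc i) x := by
    intro x hx
    obtain ⟨j, hji, hxj⟩ := S.exists_ne_of_mem hx
    have h1 := (S.act_mem hji (ball_subset_closedBall hxj)).1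
    exact ((hasDerivAt_mob _ x h1).hasFDerivAt.restrictScalars ℝ).hasFDerivWithinAt
  have hcov := lintegral_image_eq_lintegral_abs_det_fderiv_mul volume hmeas hder (S.injOn_mob i)
    (fun z => ENNReal.ofReal (‖f z‖ ^ 2))
  have hdet : ∀ a : ℂ, ((ContinuousLinearMap.toSpanSingleton ℂ a).restrictScalars ℝ).det
      = ‖a‖ ^ 2 := by
    intro a
    simp [ContinuousLinearMap.det, LinearMap.det_restrictScalars, Algebra.norm_complex_eq,
      Complex.normSq_eq_norm_sq]
  calc ∫⁻ z in S.discs, ENNReal.ofReal (‖S.opFun i s f z‖ ^ 2)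
      = ∫⁻ z in S.discs, (S.discs \ S.disc i).indicator (fun z => ENNReal.ofReal
          (‖Complex.exp (-s * S.tau (mob (S.gen (bar i)) z)) * f (mob (S.gen (bar i)) z)‖ ^ 2)) z := by
        refine lintegral_congr fun z => ?_
        by_cases hz : z ∈ S.discs \ S.disc i
        · simp [SchottkyData.opFun, Set.indicator_of_mem hz]
        · simp [SchottkyData.opFun, Set.indicator_of_notMem hz]
    _ = ∫⁻ z in S.discs \ S.disc i, ENNReal.ofReal
          (‖Complex.exp (-s * S.tau (mob (S.gen (bar i)) z)) * f (mob (S.gen (bar i)) z)‖ ^ 2) := by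
        rw [lintegral_indicator hmeas, Measure.restrict_restrict hmeas,
          Set.inter_eq_left.2 Set.sdiff_subset]
    _ ≤ ∫⁻ z in S.discs \ S.disc i, ENNReal.ofReal (M ^ 2) *
          (ENNReal.ofReal (‖1 / S.den i z ^ 2‖ ^ 2) *
            ENNReal.ofReal (‖f (mob (S.gen (bar i)) z)‖ ^ 2)) := by
        refine setLIntegral_mono' hmeas fun z hz => ?_
        rw [← ENNReal.ofReal_mul (by positivity), ← ENNReal.ofReal_mul (by positivity)]
        refine ENNReal.ofReal_le_ofReal ?_
        rw [norm_mul, mul_pow, ← mul_assoc, ← mul_pow M]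
        have := hM z hz
        gcongr
    _ = ENNReal.ofReal (M ^ 2) * ∫⁻ z in mob (S.gen (bar i)) '' (S.discs \ S.disc i),
          ENNReal.ofReal (‖f z‖ ^ 2) := by
        rw [hcov, lintegral_const_mul' _ _ ENNReal.ofReal_ne_top]
        congr 1
        refine lintegral_congr fun z => ?_
        rw [hdet, abs_of_nonneg (by positivity)]
    _ ≤ _ := mul_le_mul' le_rfl (lintegral_mono_set hsub)

theorem lintegral_sq_lt_top_iff {μ : Measure ℂ} {f : ℂ → ℂ} (hf : AEStronglyMeasurable f μ) :
    MemLp f 2 μ ↔ ∫⁻ z, ENNReal.ofReal (‖f z‖ ^ 2) ∂μ < ⊤ := by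
  rw [memLp_two_iff_integrable_sq_norm hf, Integrable, hasFiniteIntegral_iff_ofReal
    (Filter.Eventually.of_forall fun z => by positivity)]
  exact and_iff_right (hf.norm.pow 2)

theorem SchottkyData.opFun_mem (i : Color d) (s : ℂ) {f : ℂ → ℂ} (hf : f ∈ S.bergmanSubmodule) :
    S.opFun i s f ∈ S.bergmanSubmodule := by
  have hd := S.differentiableOn_opFun i s hf.1
  refine ⟨hd, ?_, fun z hz => Set.indicator_of_notMem (fun h => hz h.1) _⟩
  obtain ⟨M, hM0, hM⟩ := S.exists_weight_bound i s
  rw [lintegral_sq_lt_top_iff (hd.continuousOn.aestronglyMeasurable S.measurableSet_discs)]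
  refine (S.lintegral_opFun_le i s hM f).trans_lt (ENNReal.mul_lt_top ENNReal.ofReal_lt_top ?_)
  exact (lintegral_sq_lt_top_iff hf.2.1.1).1 hf.2.1

theorem SchottkyData.exists_opFun_bound (i : Color d) (s : ℂ) : ∃ C : ℝ, ∀ f : S.Bergman,
    ‖Bergman.mk (S.opFun i s f.val) (S.opFun_mem i s f.prop)‖ ≤ C * ‖f‖ := by
  obtain ⟨M, hM0, hM⟩ := S.exists_weight_bound i s
  exact ⟨M, fun f => Bergman.norm_le_of_lintegral hM0 (S.lintegral_opFun_le i s hM f.val)⟩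

theorem SchottkyData.opFun_add (i : Color d) (s : ℂ) (f g : ℂ → ℂ) :
    S.opFun i s (f + g) = S.opFun i s f + S.opFun i s g := by
  funext x
  by_cases hx : x ∈ S.discs \ S.disc i
  · rw [Pi.add_apply]
    simp only [SchottkyData.opFun, Set.indicator_of_mem hx, Pi.add_apply, mul_add]
  · rw [Pi.add_apply]
    simp only [SchottkyData.opFun, Set.indicator_of_notMem hx, add_zero]

theorem SchottkyData.opFun_smul (i : Color d) (s c : ℂ) (f : ℂ → ℂ) :
    S.opFun i s (c • f) = c • S.opFun i s f := by
  funext x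
  by_cases hx : x ∈ S.discs \ S.disc i
  · rw [Pi.smul_apply]
    simp only [SchottkyData.opFun, Set.indicator_of_mem hx, Pi.smul_apply, smul_eq_mul,
      mul_left_comm]
  · rw [Pi.smul_apply]
    simp only [SchottkyData.opFun, Set.indicator_of_notMem hx, smul_zero]

/-- The bounded operator `A_i(s) : 𝓗(𝐃) → 𝓗(𝐃)`. -/
noncomputable def SchottkyData.opA (i : Color d) (s : ℂ) : S.Bergman →L[ℂ] S.Bergman :=
  LinearMap.mkContinuousOfExistsBound
    { toFun := fun f => Bergman.mk (S.opFun i s f.val) (S.opFun_mem i s f.prop)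
      map_add' := fun f g => Bergman.ext_val (S.opFun_add i s f.val g.val)
      map_smul' := fun c f => Bergman.ext_val (S.opFun_smul i s c f.val) }
    (S.exists_opFun_bound i s)

theorem SchottkyData.opA_val (i : Color d) (s : ℂ) (f : S.Bergman) :
    (S.opA i s f).val = S.opFun i s f.val := rfl

theorem SchottkyData.restrict_mem (i : Color d) {f : ℂ → ℂ} (hf : f ∈ S.bergmanSubmodule) :
    (S.disc i).indicator f ∈ S.bergmanSubmodule := by
  refine ⟨fun x hx => ?_, hf.2.1.indicator measurableSet_ball, fun z hz => ?_⟩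
  · obtain ⟨j, hj⟩ := Set.mem_iUnion.1 hx
    have hnhds : S.disc j ∈ nhds x := isOpen_ball.mem_nhds hj
    by_cases hij : j = i
    · subst hij
      refine (hf.1 x hx).congr_of_eventuallyEq ?_ (Set.indicator_of_mem hj f)
      filter_upwards [nhdsWithin_le_nhds hnhds] with y hy
      exact Set.indicator_of_mem hy f
    · refine ((differentiableAt_const (0 : ℂ)).congr_of_eventuallyEq ?_).differentiableWithinAt
      filter_upwards [hnhds] with y hy
      exact Set.indicator_of_notMem (S.not_mem_disc hij hy) f
  · exact Set.indicator_of_notMem (fun h => hz (Set.mem_iUnion.2 ⟨i, h⟩)) f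

theorem SchottkyData.exists_restrict_bound (i : Color d) : ∃ C : ℝ, ∀ f : S.Bergman,
    ‖Bergman.mk ((S.disc i).indicator f.val) (S.restrict_mem i f.prop)‖ ≤ C * ‖f‖ := by
  refine ⟨1, fun f => Bergman.norm_le_of_lintegral zero_le_one ?_⟩
  rw [one_pow, ENNReal.ofReal_one, one_mul]
  refine lintegral_mono fun z => ENNReal.ofReal_le_ofReal ?_
  rw [Bergman.val_mk]
  have := norm_indicator_le_norm_self f.val (s := S.disc i) z
  gcongr

/-- The orthogonal projection `f ↦ 1_{D_i} f` of `𝓗(𝐃) = ⨁ 𝓗(D_j)` onto the summand `𝓗(D_i)`. -/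
noncomputable def SchottkyData.discProj (i : Color d) : S.Bergman →L[ℂ] S.Bergman :=
  LinearMap.mkContinuousOfExistsBound
    { toFun := fun f => Bergman.mk ((S.disc i).indicator f.val) (S.restrict_mem i f.prop)
      map_add' := fun f g => Bergman.ext_val
        (Set.indicator_add (S.disc i) f.val g.val)
      map_smul' := fun c f => Bergman.ext_val
        (Set.indicator_const_smul (S.disc i) c f.val) }
    (S.exists_restrict_bound i)

theorem SchottkyData.discProj_val (i : Color d) (f : S.Bergman) :
    (S.discProj i f).val = (S.disc i).indicator f.val := rfl

/-- Half-edges `e = (x, i)`, with `x ∈ [n]` and `i` a letter. -/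
abbrev HalfEdge (n d : ℕ) : Type := Fin n × Color d

/-- The relation `(x, i, y) ∼ (y, ī, x)`. -/
def edgeRel (n d : ℕ) (a b : Fin n × Color d × Fin n) : Prop := b = (a.2.2, bar a.2.1, a.1)

/-- Colored edges `[x, i, y]`: classes for the equivalence relation generated by
`(x, i, y) ∼ (y, ī, x)`. -/
def ColoredEdge (n d : ℕ) : Type := Quot (edgeRel n d)

/-- The colored edge `[x, i, y]`. -/
def ColoredEdge.mk {n d : ℕ} (x : Fin n) (i : Color d) (y : Fin n) : ColoredEdge n d :=
  Quot.mk _ (x, i, y)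

/-- A colored graph: a set of vertices in `[n]` and a set of colored edges. -/
structure ColoredGraph (n d : ℕ) where
  verts : Set (Fin n)
  edges : Set (ColoredEdge n d)

/-- `C` is (the edge set of) a cycle of the multigraph underlying `H`: there are distinct vertices
`x₀, …, x_m` and distinct edges `[x_t, i_t, x_{t+1}]`, indices modulo `m + 1`, with union `C`.
A loop is a cycle of length one, two parallel edges form a cycle of length two. -/
def ColoredGraph.IsCycle {n d : ℕ} (H : ColoredGraph n d) (C : Set (ColoredEdge n d)) : Prop :=
  ∃ (m : ℕ) (x : Fin (m + 1) → Fin n) (i : Fin (m + 1) → Color d),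
    Function.Injective x ∧
    Function.Injective (fun t => ColoredEdge.mk (x t) (i t) (x (t + 1))) ∧
    C = Set.range (fun t => ColoredEdge.mk (x t) (i t) (x (t + 1))) ∧
    C ⊆ H.edges

/-- A colored graph is tangle-free if it contains at most one cycle. -/
def ColoredGraph.TangleFree {n d : ℕ} (H : ColoredGraph n d) : Prop :=
  ∀ C C' : Set (ColoredEdge n d), H.IsCycle C → H.IsCycle C' → C = C'

/-- The colored graph `G_γ` of a path `γ = ((x₁, i₁), …, (x_k, i_k))`, with vertices `x_t`,
`1 ≤ t ≤ k`, and edges `[x_t, i_t, x_{t+1}]`, `1 ≤ t ≤ k - 1`. -/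
def pathGraph {n d : ℕ} (γ : List (HalfEdge n d)) : ColoredGraph n d where
  verts := {x | ∃ e ∈ γ, x = e.1}
  edges := {ε | ∃ (t : ℕ) (h : t + 1 < γ.length),
    ε = ColoredEdge.mk (γ[t]).1 (γ[t]).2 (γ[t + 1]).1}

/-- `γ` is non-backtracking: `i_t ≠ ī_{t+1}` for consecutive half-edges. -/
def NonBacktracking {n d : ℕ} (γ : List (HalfEdge n d)) : Prop :=
  γ.IsChain fun e f => e.2 ≠ bar f.2

/-- Non-backtracking tangle-free paths, the set `F`. -/
def MemF {n d : ℕ} (γ : List (HalfEdge n d)) : Prop :=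
  NonBacktracking γ ∧ (pathGraph γ).TangleFree

/-- The set `F_k`: non-backtracking paths such that the path formed by the first `k` half-edges and
the path formed by the remaining half-edges are both tangle-free. -/
def MemFk {n d : ℕ} (k : ℕ) (γ : List (HalfEdge n d)) : Prop :=
  NonBacktracking γ ∧ (pathGraph (γ.take k)).TangleFree ∧ (pathGraph (γ.drop k)).TangleFree

/-- The `2d` symmetric permutations determined by `σ₁, …, σ_d`: `σ_ī = σ_i⁻¹`. -/
def symPerm {n d : ℕ} (σ : Fin d → Equiv.Perm (Fin n)) (i : Color d) : Equiv.Perm (Fin n) :=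
  if i.2 then (σ i.1)⁻¹ else σ i.1

/-- The entry `(S_i)_{xy} = 1{σ_i(x) = y}`. -/
def permEntry {n d : ℕ} (σ : Fin d → Equiv.Perm (Fin n)) (i : Color d) (x y : Fin n) : ℂ :=
  if symPerm σ i x = y then 1 else 0

/-- The entry of `S_i - (1/n) 𝟏 ⊗ 𝟏`. -/
noncomputable def permEntryCentered {n d : ℕ} (σ : Fin d → Equiv.Perm (Fin n)) (i : Color d)
    (x y : Fin n) : ℂ :=
  permEntry σ i x y - 1 / (n : ℂ)

/-- `A(s)_𝐢 = A_{i₁}(s) A_{i₂}(s) ⋯ A_{i_ℓ}(s)`. -/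
noncomputable def SchottkyData.wordOp (s : ℂ) (w : List (Color d)) : S.Bergman →L[ℂ] S.Bergman :=
  (w.map fun i => S.opA i s).prod

/-- The Hilbert space `𝓗(𝐃) ⊗ ℓ²([n])`, as the `ℓ²`-direct sum of the `𝓗(𝐃) ⊗ ℂx`, `x ∈ [n]`. -/
abbrev SchottkyData.Space (n : ℕ) : Type := PiLp 2 fun _ : Fin n => S.Bergman

/-- The operator `A ⊗ 𝓔_{xy}` on `𝓗(𝐃) ⊗ ℓ²([n])`, where `𝓔_{xy}` maps `y` to `x` and all other
basis vectors to `0`. -/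
noncomputable def SchottkyData.tensorE {n : ℕ} (A : S.Bergman →L[ℂ] S.Bergman) (x y : Fin n) :
    S.Space n →L[ℂ] S.Space n :=
  LinearMap.mkContinuous
    { toFun := fun v => PiLp.single 2 x (A (v y))
      map_add' := fun v w => by simp [PiLp.single_add]
      map_smul' := fun c v => by
        ext z
        by_cases h : z = x
        · subst h; simp
        · simp }
    ‖A‖ fun v => by
      change ‖(PiLp.single 2 x (A (v y)) : S.Space n)‖ ≤ ‖A‖ * ‖v‖
      rw [PiLp.norm_single]
      exact (A.le_opNorm _).trans
        (mul_le_mul_of_nonneg_left (PiLp.norm_apply_le v y) (norm_nonneg _))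

/-- The orthogonal projection `𝔭_e` onto `𝓗(D_ī) ⊗ ℂx`, for `e = (x, i)`. -/
noncomputable def SchottkyData.edgeProj {n : ℕ} (e : HalfEdge n d) : S.Space n →L[ℂ] S.Space n :=
  S.tensorE (S.discProj (bar e.2)) e.1 e.1

open Classical in
/-- The operator `R_k(s)^{(ℓ)}`: the sum over `γ ∈ F_k^{ℓ+1} ∖ F^{ℓ+1}` of
`𝔭_{γ₁} [A(s)_{(i₂, …, i_{ℓ+1})} ⊗ 𝓔_{x₁ x_{ℓ+1}}] 𝔭_{γ_{ℓ+1}}`, with the weights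
`∏_{t=1}^{k-1} (S_{i_t} - 1/n)_{x_t x_{t+1}} ∏_{t=k+1}^{ℓ} (S_{i_t})_{x_t x_{t+1}}`.
Positions are counted from `0` below, so that the position `t` of the formula is `t - 1`. -/
noncomputable def SchottkyData.remainder (n ℓ k : ℕ) (s : ℂ) (σ : Fin d → Equiv.Perm (Fin n)) :
    S.Space n →L[ℂ] S.Space n :=
  ∑ γ : Fin (ℓ + 1) → HalfEdge n d with MemFk k (List.ofFn γ) ∧ ¬ MemF (List.ofFn γ),
    ((∏ t : Fin ℓ with t.val + 1 < k,
        permEntryCentered σ (γ t.castSucc).2 (γ t.castSucc).1 (γ t.succ).1) *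
      ∏ t : Fin ℓ with k ≤ t.val,
        permEntry σ (γ t.castSucc).2 (γ t.castSucc).1 (γ t.succ).1) •
      (S.edgeProj (γ 0) ∘L
        S.tensorE (S.wordOp s ((List.ofFn γ).tail.map Prod.snd)) (γ 0).1 (γ (Fin.last ℓ)).1 ∘L
        S.edgeProj (γ (Fin.last ℓ)))

open Classical in
/-- The probability of an event for independent uniform permutations `σ₁, …, σ_d` of `[n]`. -/
noncomputable def prob (n d : ℕ) (P : (Fin d → Equiv.Perm (Fin n)) → Prop) : ℝ :=
  ((Finset.univ.filter P).card : ℝ) / (Fintype.card (Fin d → Equiv.Perm (Fin n)) : ℝ)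

end Schottky

/-!
The constant `ρ₁` may depend on `K` and the Schottky data, so that factors exponential in `ℓ` are
free, and it is enough to bound absolute values. The operators `A_i(s)` are bounded by one constant
`C` for all `s ∈ K` (`SchottkyData.exists_norm_opA_le`), and `|S_{xy}|` and `|S_{xy} - 1/n|` are at
most `S_{xy} + 1/n`, a kernel on half-edges all of whose rows and columns have sum `4d`
(`majorant`). By Schur's test (`opNorm_le_of_row_col_sum_le`), the operator norm of the remainder is
at most `C ^ ℓ` times a bound for the total weight of the tangled paths with a given first vertex,
and of those with a given last vertex. The step between the two pieces of a path has weight `1`,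
which a priori costs a factor `n`; tangledness has to compensate for it.

If both pieces are tangle-free but the path is not, there are two cases (`PiecesTangled`). Either
the pieces have a common vertex. Then the second piece is chosen by a walk from one of the vertices
of the first, and the total weight is at most `poly(ℓ) (4d) ^ ℓ` for every choice of permutations.
Or the pieces are disjoint. Then the joining edge lies in no cycle, so each piece contains a cycle
(`isCycle_of_append`), hence a circuit, namely a shortest return to a vertex
(`containsCircuit_of_not_injective`). For weights `S + 1/n`, the total weight of paths that contain
a circuit is controlled by the number of circuits of the random graph itself: in a circuit with a
step of weight `1/n`, this weight compensates for the choice of the starting vertex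
(`sum_circuit_weight_le`). So everything reduces to the number `N` of circuits of length at most
`ℓ` (`SchottkyData.norm_remainder_le`).

The number `N` is bounded through the `m`-tuples of circuits with disjoint sets of vertices. Each
circuit meets at most `exp(O(ℓ))` others, so that there are at least `(N - m exp(O(ℓ))) ^ m` such
tuples (`pow_le_disjointTuples`). Their expected number is at most `exp(O(ℓ m))`, since `k`
distinct conditions `σ_c(a) = b` hold with probability at most `(2/n) ^ k` for `k ≤ n/2`
(`card_satisfying_le`, `sum_disjointTuples_le`). By Markov's inequality,
`N ≥ m exp(O(ℓ))` has probability at most `3 ^ (-m)`. With `m` about `ℓ log n`, this is stronger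
than required, and the bound for the norm is `(log n) ρ₁ ^ ℓ`.
-/

namespace Schottky

/-! ### Probabilities for uniform permutations -/

/-- The condition on `σ₁, …, σ_d` expressed by `σ_i(x) = y`, written as the triple `(c, a, b)`
that stands for `σ_c(a) = b` with `c` one of the first `d` letters. -/
def constraintOf {n d : ℕ} (x : Fin n) (i : Color d) (y : Fin n) : Fin d × Fin n × Fin n :=
  if i.2 then (i.1, y, x) else (i.1, x, y)

theorem symPerm_apply_eq_iff {n d : ℕ} (σ : Fin d → Equiv.Perm (Fin n)) (x : Fin n) (i : Color d)
    (y : Fin n) : symPerm σ i x = y ↔ σ (constraintOf x i y).1 (constraintOf x i y).2.1 =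
      (constraintOf x i y).2.2 := by
  obtain ⟨c, b⟩ := i
  cases b
  · simp [symPerm, constraintOf]
  · simp only [symPerm, constraintOf, if_true, Equiv.Perm.inv_eq_iff_eq]
    exact eq_comm

theorem constraintOf_eq_iff {n d : ℕ} {x x' y y' : Fin n} {i i' : Color d} :
    constraintOf x i y = constraintOf x' i' y' ↔
      (x = x' ∧ i = i' ∧ y = y') ∨ (x = y' ∧ i = bar i' ∧ y = x') := by
  obtain ⟨c, b⟩ := i
  obtain ⟨c', b'⟩ := i'
  cases b <;> cases b' <;> simp [constraintOf, bar] <;> tauto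

/-- The families of permutations that satisfy every constraint `σ_c(a) = b`, `(c, a, b) ∈ E`. -/
def satisfying {n d : ℕ} (E : Finset (Fin d × Fin n × Fin n)) :
    Finset (Fin d → Equiv.Perm (Fin n)) :=
  Finset.univ.filter fun σ => ∀ e ∈ E, σ e.1 e.2.1 = e.2.2

theorem mem_satisfying {n d : ℕ} {E : Finset (Fin d × Fin n × Fin n)}
    {σ : Fin d → Equiv.Perm (Fin n)} :
    σ ∈ satisfying E ↔ ∀ e ∈ E, σ e.1 e.2.1 = e.2.2 := by
  simp [satisfying]

/-- One more constraint `σ_c(a) = b` costs a factor `n - |E|`: composing `σ_c` with the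
transposition of `b` and `y` moves the value at `a` to any `y` that is no target of `E`, and keeps
the constraints in `E`. -/
theorem card_satisfying_insert {n d : ℕ} {E : Finset (Fin d × Fin n × Fin n)}
    {e : Fin d × Fin n × Fin n} (he : e ∉ E) :
    (satisfying (insert e E)).card * (n - E.card) ≤ (satisfying E).card := by
  obtain ⟨c, a, b⟩ := e
  set Y : Finset (Fin n) := (E.image fun e => e.2.2)ᶜ with hY
  have hYcard : n - E.card ≤ Y.card := by
    rw [hY, Finset.card_compl, Fintype.card_fin]
    exact Nat.sub_le_sub_left Finset.card_image_le n
  refine (Nat.mul_le_mul_left _ hYcard).trans ?_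
  rw [← Finset.card_product]
  refine Finset.card_le_card_of_injOn
    (fun p => Function.update p.1 c (Equiv.swap b p.2 * p.1 c)) ?_ ?_
  · rintro ⟨σ, y⟩ hp
    rw [Finset.mem_coe, Finset.mem_product, mem_satisfying] at hp
    obtain ⟨hσ, hy⟩ := hp
    have hab : σ c a = b := hσ _ (Finset.mem_insert_self _ _)
    rw [Finset.mem_coe, mem_satisfying]
    rintro ⟨c', a', b'⟩ he'
    have h' : σ c' a' = b' := hσ _ (Finset.mem_insert_of_mem he')
    by_cases hc : c' = c
    · subst hc
      have hbb : b' ≠ b := by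
        rintro rfl
        have : a' = a := (σ c').injective (h'.trans hab.symm)
        exact he (this ▸ he')
      have hby : b' ≠ y := by
        rintro rfl
        simp only [hY, Finset.mem_compl, Finset.mem_image, not_exists, not_and] at hy
        exact hy _ he' rfl
      simp [h', Equiv.swap_apply_of_ne_of_ne hbb hby]
    · simp [Function.update_of_ne hc, h']
  · rintro ⟨σ, y⟩ hp ⟨σ', y'⟩ hp' h
    rw [Finset.mem_coe, Finset.mem_product, mem_satisfying] at hp hp'
    have hab : σ c a = b := hp.1 _ (Finset.mem_insert_self _ _)
    have hab' : σ' c a = b := hp'.1 _ (Finset.mem_insert_self _ _)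
    dsimp only at h
    have hc := congrFun h c
    rw [Function.update_self, Function.update_self] at hc
    have hyy : y = y' := by
      have := congrArg (fun g : Equiv.Perm (Fin n) => g a) hc
      simpa [hab, hab'] using this
    subst hyy
    refine Prod.ext (funext fun c' => ?_) rfl
    by_cases hcc : c' = c
    · subst hcc
      exact mul_left_cancel hc
    · have := congrFun h c'
      simpa [Function.update_of_ne hcc] using this

/-- A set `E` of at most `n / 2` constraints holds with probability at most `(2 / n) ^ |E|`. -/
theorem card_satisfying_le {n d : ℕ} (E : Finset (Fin d × Fin n × Fin n)) (hE : 2 * E.card ≤ n) :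
    (satisfying E).card * n ^ E.card ≤
      2 ^ E.card * Fintype.card (Fin d → Equiv.Perm (Fin n)) := by
  induction E using Finset.induction_on with
  | empty => simpa using Finset.card_le_univ (satisfying (∅ : Finset (Fin d × Fin n × Fin n)))
  | insert e E he ih =>
    rw [Finset.card_insert_of_notMem he] at hE ⊢
    have h1 := card_satisfying_insert he
    calc (satisfying (insert e E)).card * n ^ (E.card + 1)
        = (satisfying (insert e E)).card * n * n ^ E.card := by ring
      _ ≤ (satisfying (insert e E)).card * (2 * (n - E.card)) * n ^ E.card := by
          gcongr
          omega
      _ = 2 * ((satisfying (insert e E)).card * (n - E.card)) * n ^ E.card := by ring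
      _ ≤ 2 * (satisfying E).card * n ^ E.card := by gcongr
      _ = 2 * ((satisfying E).card * n ^ E.card) := by ring
      _ ≤ 2 * (2 ^ E.card * Fintype.card (Fin d → Equiv.Perm (Fin n))) := by
          exact Nat.mul_le_mul_left _ (ih (by omega))
      _ = _ := by ring

/-! ### Sums over paths with multiplicative weights -/

section PathWeight

variable {H : Type*}

/-- The weight `P(η₀, η₁) P(η₁, η₂) ⋯ P(η_{L-1}, η_L)` of a sequence for a kernel `P`. -/
def pathWeight (P : H → H → ℝ) {L : ℕ} (η : Fin (L + 1) → H) : ℝ :=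
  ∏ t : Fin L, P (η t.castSucc) (η t.succ)

theorem pathWeight_nonneg {P : H → H → ℝ} (hP : ∀ e f, 0 ≤ P e f) {L : ℕ}
    (η : Fin (L + 1) → H) : 0 ≤ pathWeight P η :=
  Finset.prod_nonneg fun _ _ => hP _ _

/-- The first `k + 1` terms of a sequence of length `(k + 1) + (L + 1)`. -/
def firstPiece {k L : ℕ} (γ : Fin (k + 1 + L + 1) → H) : Fin (k + 1) → H :=
  fun u => γ ⟨u, by omega⟩

/-- The last `L + 1` terms of a sequence of length `(k + 1) + (L + 1)`. -/
def secondPiece {k L : ℕ} (γ : Fin (k + 1 + L + 1) → H) : Fin (L + 1) → H :=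
  fun u => γ ⟨k + 1 + u, by omega⟩

theorem prod_filter_lt_eq_pathWeight (P : H → H → ℝ) {k L : ℕ} (γ : Fin (k + 1 + L + 1) → H) :
    ∏ t : Fin (k + 1 + L) with t.val + 1 < k + 1, P (γ t.castSucc) (γ t.succ) =
      pathWeight P (firstPiece γ) := by
  symm
  refine Finset.prod_nbij (fun t : Fin k => (⟨t, by omega⟩ : Fin (k + 1 + L))) ?_ ?_ ?_ ?_
  · intro t _
    simp
  · intro t _ t' _ h
    simpa [Fin.ext_iff] using h
  · intro t ht
    simp only [Finset.coe_filter, Finset.mem_univ, true_and, Set.mem_ofPred_eq] at ht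
    exact ⟨⟨t, by omega⟩, by simp, rfl⟩
  · intro t _
    rfl

theorem prod_filter_ge_eq_pathWeight (P : H → H → ℝ) {k L : ℕ} (γ : Fin (k + 1 + L + 1) → H) :
    ∏ t : Fin (k + 1 + L) with k + 1 ≤ t.val, P (γ t.castSucc) (γ t.succ) =
      pathWeight P (secondPiece γ) := by
  symm
  refine Finset.prod_nbij (fun t : Fin L => (⟨k + 1 + t, by omega⟩ : Fin (k + 1 + L))) ?_ ?_ ?_ ?_
  · intro t _
    simp only [Finset.mem_filter, Finset.mem_univ, true_and]
    omega
  · intro t _ t' _ h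
    simpa [Fin.ext_iff] using h
  · intro t ht
    simp only [Finset.coe_filter, Finset.mem_univ, true_and, Set.mem_ofPred_eq] at ht
    exact ⟨⟨t - (k + 1), by omega⟩, by simp, by simp [Fin.ext_iff]; omega⟩
  · intro t _
    rfl

theorem prod_filter_ne_eq_pathWeight (P : H → H → ℝ) {k L : ℕ} (γ : Fin (k + 1 + L + 1) → H) :
    ∏ t : Fin (k + 1 + L) with t.val ≠ k, P (γ t.castSucc) (γ t.succ) =
      pathWeight P (firstPiece γ) * pathWeight P (secondPiece γ) := by
  rw [← prod_filter_lt_eq_pathWeight, ← prod_filter_ge_eq_pathWeight, ← Finset.prod_union]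
  · refine Finset.prod_congr ?_ fun _ _ => rfl
    ext t
    simp only [Finset.mem_filter, Finset.mem_univ, true_and, Finset.mem_union]
    omega
  · rw [Finset.disjoint_filter]
    intro t _ h
    omega

theorem sum_pieces [Fintype H] {k L : ℕ} (F : (Fin (k + 1) → H) → (Fin (L + 1) → H) → ℝ) :
    ∑ γ : Fin (k + 1 + L + 1) → H, F (firstPiece γ) (secondPiece γ) = ∑ η, ∑ θ, F η θ := by
  rw [← Fintype.sum_prod_type' (f := F)]
  refine (Fintype.sum_equiv (Fin.appendEquiv (α := H) (k + 1) (L + 1)) _ _ ?_).symm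
  rintro ⟨η, θ⟩
  have h1 : firstPiece (k := k) (L := L) (Fin.append (m := k + 1) (n := L + 1) η θ) = η := by
    funext u
    exact Fin.append_left η θ u
  have h2 : secondPiece (k := k) (L := L) (Fin.append (m := k + 1) (n := L + 1) η θ) = θ := by
    funext u
    exact Fin.append_right η θ u
  exact (congrArg₂ F h1 h2).symm

variable [Fintype H] {P : H → H → ℝ} {Θ : ℝ}

/-- Summing out the last term of a sequence. -/
theorem sum_pathWeight_init_le (hP : ∀ e f, 0 ≤ P e f) (hrow : ∀ e, ∑ f, P e f ≤ Θ) {L : ℕ}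
    (g : (Fin (L + 1) → H) → ℝ) (hg : ∀ ζ, 0 ≤ g ζ) :
    ∑ η : Fin (L + 2) → H, pathWeight P η * g (fun u => η u.castSucc) ≤
      Θ * ∑ η : Fin (L + 1) → H, pathWeight P η * g η := by
  rw [← (Fin.snocEquiv fun _ : Fin (L + 2) => H).sum_comp, Fintype.sum_prod_type_right,
    Finset.mul_sum]
  refine Finset.sum_le_sum fun ζ _ => ?_
  have h : ∀ f : H, pathWeight P (Fin.snocEquiv (fun _ : Fin (L + 2) => H) (f, ζ)) *
      g (fun u => Fin.snocEquiv (fun _ : Fin (L + 2) => H) (f, ζ) u.castSucc) =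
      P (ζ (Fin.last L)) f * (pathWeight P ζ * g ζ) := by
    intro f
    have h1 : pathWeight P (Fin.snocEquiv (fun _ : Fin (L + 2) => H) (f, ζ)) =
        pathWeight P ζ * P (ζ (Fin.last L)) f := by
      simp only [pathWeight, Fin.snocEquiv, Equiv.coe_fn_mk]
      rw [Fin.prod_univ_castSucc]
      simp only [Fin.succ_last, Fin.snoc_last, Fin.snoc_castSucc, ← Fin.castSucc_succ]
    rw [h1]
    simp only [Fin.snocEquiv, Equiv.coe_fn_mk, Fin.snoc_castSucc]
    ring
  rw [Finset.sum_congr rfl fun f _ => h f, ← Finset.sum_mul]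
  exact mul_le_mul_of_nonneg_right (hrow _) (mul_nonneg (pathWeight_nonneg hP _) (hg _))

/-- Summing out the first term of a sequence. -/
theorem sum_pathWeight_tail_le (hP : ∀ e f, 0 ≤ P e f) (hcol : ∀ f, ∑ e, P e f ≤ Θ) {L : ℕ}
    (g : (Fin (L + 1) → H) → ℝ) (hg : ∀ ζ, 0 ≤ g ζ) :
    ∑ η : Fin (L + 2) → H, pathWeight P η * g (fun u => η u.succ) ≤
      Θ * ∑ η : Fin (L + 1) → H, pathWeight P η * g η := by
  rw [← (Fin.consEquiv fun _ : Fin (L + 2) => H).sum_comp, Fintype.sum_prod_type_right,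
    Finset.mul_sum]
  refine Finset.sum_le_sum fun ζ _ => ?_
  have h : ∀ f : H, pathWeight P (Fin.consEquiv (fun _ : Fin (L + 2) => H) (f, ζ)) *
      g (fun u => Fin.consEquiv (fun _ : Fin (L + 2) => H) (f, ζ) u.succ) =
      P f (ζ 0) * (pathWeight P ζ * g ζ) := by
    intro f
    have h1 : pathWeight P (Fin.consEquiv (fun _ : Fin (L + 2) => H) (f, ζ)) =
        P f (ζ 0) * pathWeight P ζ := by
      simp only [pathWeight, Fin.consEquiv, Equiv.coe_fn_mk]
      rw [Fin.prod_univ_succ]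
      simp only [Fin.castSucc_zero, Fin.cons_zero, Fin.cons_succ, Fin.castSucc_succ]
    rw [h1]
    simp only [Fin.consEquiv, Equiv.coe_fn_mk, Fin.cons_succ]
    ring
  rw [Finset.sum_congr rfl fun f _ => h f, ← Finset.sum_mul]
  exact mul_le_mul_of_nonneg_right (hcol _) (mul_nonneg (pathWeight_nonneg hP _) (hg _))

/-- Summing out the steps outside the segment `[a, a + c]` costs at most a factor `Θ` for each. -/
theorem sum_pathWeight_segment_le (hP : ∀ e f, 0 ≤ P e f) (hΘ : 0 ≤ Θ)
    (hrow : ∀ e, ∑ f, P e f ≤ Θ)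
    (hcol : ∀ f, ∑ e, P e f ≤ Θ) {L a c : ℕ} (h : a + c ≤ L) (g : (Fin (c + 1) → H) → ℝ)
    (hg : ∀ ζ, 0 ≤ g ζ) :
    ∑ η : Fin (L + 1) → H, pathWeight P η * g (fun u => η ⟨a + u, by omega⟩) ≤
      Θ ^ (L - c) * ∑ ζ : Fin (c + 1) → H, pathWeight P ζ * g ζ := by
  induction L generalizing a with
  | zero =>
    obtain rfl : a = 0 := by omega
    obtain rfl : c = 0 := by omega
    simp only [Nat.zero_add, Nat.sub_self, pow_zero, one_mul, le_refl]
  | succ L ih =>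
    by_cases h1 : a + c ≤ L
    · refine (sum_pathWeight_init_le hP hrow
        (fun η : Fin (L + 1) → H => g fun u => η ⟨a + u, by omega⟩) fun _ => hg _).trans ?_
      refine (mul_le_mul_of_nonneg_left (ih h1) hΘ).trans_eq ?_
      rw [← mul_assoc, ← pow_succ', show L + 1 - c = L - c + 1 by omega]
    · rcases a with _ | a
      · obtain rfl : c = L + 1 := by omega
        simp
      · have h2 : ∀ η : Fin (L + 2) → H, (fun u : Fin (c + 1) => η ⟨a + 1 + u, by omega⟩) =
            fun u : Fin (c + 1) => (fun v : Fin (L + 1) => η v.succ) ⟨a + u, by omega⟩ := by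
          intro η
          funext u
          congr 1
          ext
          simp
          omega
        simp only [h2]
        refine (sum_pathWeight_tail_le hP hcol
          (fun η : Fin (L + 1) → H => g fun u => η ⟨a + u, by omega⟩) fun _ => hg _).trans ?_
        refine (mul_le_mul_of_nonneg_left (ih (by omega)) hΘ).trans_eq ?_
        rw [← mul_assoc, ← pow_succ', show L + 1 - c = L - c + 1 by omega]

theorem sum_pathWeight_position_le (hP : ∀ e f, 0 ≤ P e f) (hΘ : 0 ≤ Θ)
    (hrow : ∀ e, ∑ f, P e f ≤ Θ) (hcol : ∀ f, ∑ e, P e f ≤ Θ) {L : ℕ} (a : Fin (L + 1))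
    (p : H → ℝ) (hp : ∀ e, 0 ≤ p e) :
    ∑ η : Fin (L + 1) → H, pathWeight P η * p (η a) ≤ (∑ e, p e) * Θ ^ L := by
  have h := sum_pathWeight_segment_le hP hΘ hrow hcol (L := L) (a := a) (c := 0)
    (by have := a.2; omega) (fun ζ => p (ζ 0)) fun _ => hp _
  have h2 : ∑ ζ : Fin (0 + 1) → H, pathWeight P ζ * p (ζ 0) = ∑ e, p e := by
    rw [← (Equiv.funUnique (Fin 1) H).symm.sum_comp]
    simp [pathWeight]
  rw [h2] at h
  simpa [mul_comm] using h

end PathWeight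

/-! ### Tangles and circuits -/

section Tangles

variable {n d : ℕ}

theorem ColoredEdge.mk_eq {x x' y y' : Fin n} {i i' : Color d}
    (h : ColoredEdge.mk x i y = ColoredEdge.mk x' i' y') :
    (x = x' ∧ y = y') ∨ (x = y' ∧ y = x') := by
  have h1 : ∀ a b : Fin n × Color d × Fin n, edgeRel n d a b →
      constraintOf a.1 a.2.1 a.2.2 = constraintOf b.1 b.2.1 b.2.2 := by
    rintro ⟨a, i, b⟩ _ rfl
    exact constraintOf_eq_iff.2 (Or.inr ⟨rfl, (bar_bar i).symm, rfl⟩)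
  have h2 : constraintOf x i y = constraintOf x' i' y' :=
    congrArg (Quot.lift (fun a : Fin n × Color d × Fin n => constraintOf a.1 a.2.1 a.2.2) h1) h
  rcases constraintOf_eq_iff.1 h2 with ⟨h, -, h'⟩ | ⟨h, -, h'⟩
  · exact Or.inl ⟨h, h'⟩
  · exact Or.inr ⟨h, h'⟩

/-- The graph of a path without repeated vertices is a segment. A cycle in it would have a vertex of
largest position, and both cycle edges at this vertex would be the path edge that ends there. -/
theorem not_nodup_of_isCycle {l : List (HalfEdge n d)} {C : Set (ColoredEdge n d)}
    (h : (pathGraph l).IsCycle C) : ¬ (l.map Prod.fst).Nodup := by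
  intro hnd
  obtain ⟨m, x, i, -, hedge, rfl, hsub⟩ := h
  have hinj : ∀ (a b : ℕ) (ha : a < l.length) (hb : b < l.length), l[a].1 = l[b].1 → a = b := by
    intro a b ha hb hab
    have := (List.nodup_iff_injective_getElem.1 hnd)
      (a₁ := ⟨a, by simpa using ha⟩) (a₂ := ⟨b, by simpa using hb⟩) (by simpa using hab)
    simpa using this
  have hu : ∀ t, ∃ (u : ℕ) (hu : u + 1 < l.length),
      ColoredEdge.mk (x t) (i t) (x (t + 1)) = ColoredEdge.mk l[u].1 l[u].2 l[u + 1].1 :=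
    fun t => hsub ⟨t, rfl⟩
  choose u hul hue using hu
  have hpos : ∀ t, ∃ (q : ℕ) (hq : q < l.length), x t = l[q].1 := by
    intro t
    rcases ColoredEdge.mk_eq (hue t) with ⟨h, -⟩ | ⟨h, -⟩
    · exact ⟨u t, by have := hul t; omega, h⟩
    · exact ⟨u t + 1, hul t, h⟩
  choose q hql hqx using hpos
  have hstep : ∀ t, (q t = u t ∧ q (t + 1) = u t + 1) ∨ (q t = u t + 1 ∧ q (t + 1) = u t) := by
    intro t
    have hlt := hul t
    rcases ColoredEdge.mk_eq (hue t) with ⟨h, h'⟩ | ⟨h, h'⟩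
    · exact Or.inl ⟨hinj _ _ (hql _) (by omega) ((hqx _).symm.trans h),
        hinj _ _ (hql _) (by omega) ((hqx _).symm.trans h')⟩
    · exact Or.inr ⟨hinj _ _ (hql _) (by omega) ((hqx _).symm.trans h),
        hinj _ _ (hql _) (by omega) ((hqx _).symm.trans h')⟩
  -- At a vertex of largest position, the two cycle edges have the same position `u`.
  obtain ⟨t, ht⟩ := Finite.exists_max q
  have h1 := hstep t
  have h2 := hstep (t - 1)
  rw [sub_add_cancel] at h2
  have h3 := ht (t + 1)
  have h4 := ht (t - 1)
  have huu : u (t - 1) = u t := by omega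
  have htt : t - 1 = t := by
    apply hedge
    have e1 := hue (t - 1)
    have e2 := hue t
    simp only [huu] at e1
    exact e1.trans e2.symm
  have h5 : t + 1 = t := by
    conv_lhs => rw [← htt]
    rw [sub_add_cancel]
  rw [h5] at h1
  omega

open scoped Fin.NatCast Fin.CommRing in
/-- Two paths on disjoint sets of vertices, joined by one edge: a cycle does not use the joining
edge, since it would have to cross between the two sets of vertices exactly once. So it lies in
one of the two pieces. -/
theorem isCycle_of_append {l l' : List (HalfEdge n d)} (hdisj : ∀ e ∈ l, ∀ f ∈ l', e.1 ≠ f.1)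
    {C : Set (ColoredEdge n d)} (h : (pathGraph (l ++ l')).IsCycle C) :
    (pathGraph l).IsCycle C ∨ (pathGraph l').IsCycle C := by
  obtain ⟨m, x, i, hx, hedge, rfl, hsub⟩ := h
  obtain ⟨p, hp⟩ : ∃ p : Fin (m + 1) → Prop, ∀ t, p t ↔ ∃ e ∈ l, e.1 = x t := ⟨_, fun _ => Iff.rfl⟩
  -- Cycle edges of the first piece, of the second piece, and the joining edge.
  have hcase : ∀ t,
      (p t ∧ p (t + 1) ∧ ColoredEdge.mk (x t) (i t) (x (t + 1)) ∈ (pathGraph l).edges) ∨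
      (¬ p t ∧ ¬ p (t + 1) ∧ ColoredEdge.mk (x t) (i t) (x (t + 1)) ∈ (pathGraph l').edges) ∨
      ((p t ↔ ¬ p (t + 1)) ∧ ∃ (h1 : l.length - 1 < (l ++ l').length)
        (h2 : l.length < (l ++ l').length),
        ColoredEdge.mk (x t) (i t) (x (t + 1)) =
          ColoredEdge.mk ((l ++ l')[l.length - 1]).1 ((l ++ l')[l.length - 1]).2
            ((l ++ l')[l.length]).1) := by
    intro t
    obtain ⟨u, hu, he⟩ := hsub ⟨t, rfl⟩
    dsimp only at he
    have hlen := List.length_append (as := l) (bs := l')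
    rcases lt_trichotomy (u + 1) l.length with h | h | h
    · left
      have e1 : (l ++ l')[u] = l[u] := List.getElem_append_left (by omega)
      have e2 : (l ++ l')[u + 1] = l[u + 1] := List.getElem_append_left h
      rw [e1, e2] at he
      refine ⟨?_, ?_, u, h, he⟩
      · rcases ColoredEdge.mk_eq he with ⟨h, -⟩ | ⟨h, -⟩
        · exact (hp _).2 ⟨_, List.getElem_mem _, h.symm⟩
        · exact (hp _).2 ⟨_, List.getElem_mem _, h.symm⟩
      · rcases ColoredEdge.mk_eq he with ⟨-, h⟩ | ⟨-, h⟩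
        · exact (hp _).2 ⟨_, List.getElem_mem _, h.symm⟩
        · exact (hp _).2 ⟨_, List.getElem_mem _, h.symm⟩
    · right; right
      have e1 : (l ++ l')[u] = l[u] := List.getElem_append_left (by omega)
      have e2 : (l ++ l')[u + 1] = l'[u + 1 - l.length] := List.getElem_append_right (by omega)
      have hpu : ∃ e ∈ l, e.1 = ((l ++ l')[u]).1 := by
        rw [e1]
        exact ⟨_, List.getElem_mem _, rfl⟩
      have hnu : ¬ ∃ e ∈ l, e.1 = ((l ++ l')[u + 1]).1 := by
        rintro ⟨e, hel, hex⟩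
        exact hdisj e hel _ (List.getElem_mem _) (hex.trans (by rw [e2]))
      refine ⟨?_, by omega, by omega, ?_⟩
      · rcases ColoredEdge.mk_eq he with ⟨h, h'⟩ | ⟨h, h'⟩
        · rw [hp, hp, h, h']
          exact iff_of_true hpu hnu
        · rw [hp, hp, h, h']
          exact iff_of_false hnu (not_not_intro hpu)
      · have hu' : u = l.length - 1 := by omega
        simp only [← h, Nat.add_sub_cancel]
        exact he
    · right; left
      have e1 : (l ++ l')[u] = l'[u - l.length] := List.getElem_append_right (by omega)
      have e2 : (l ++ l')[u + 1] = l'[u - l.length + 1] := by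
        rw [List.getElem_append_right (by omega)]
        congr 1
        omega
      rw [e1, e2] at he
      have hn : ∀ (v : Fin n) (w : ℕ) (hw : w < l'.length), v = (l'[w]).1 →
          ¬ ∃ e ∈ l, e.1 = v := by
        rintro v w hw hv ⟨e, hel, hex⟩
        exact hdisj e hel _ (List.getElem_mem _) (hex.trans hv)
      refine ⟨?_, ?_, u - l.length, by omega, he⟩
      · rcases ColoredEdge.mk_eq he with ⟨h, -⟩ | ⟨h, -⟩
        · rw [hp]
          exact hn _ _ _ h
        · rw [hp]
          exact hn _ _ _ h
      · rcases ColoredEdge.mk_eq he with ⟨-, h⟩ | ⟨-, h⟩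
        · rw [hp]
          exact hn _ _ _ h
        · rw [hp]
          exact hn _ _ _ h
  by_cases hb : ∃ t₀, p t₀ ↔ ¬ p (t₀ + 1)
  · exfalso
    obtain ⟨t₀, ht₀⟩ := hb
    have huniq : ∀ t, (p t ↔ ¬ p (t + 1)) → t = t₀ := by
      intro t ht
      rcases hcase t with h | h | ⟨-, h1, h2, h3⟩
      · tauto
      · tauto
      rcases hcase t₀ with h | h | ⟨-, h1', h2', h3'⟩
      · tauto
      · tauto
      exact hedge (h3.trans h3'.symm)
    -- From `t₀ + 1` once around to `t₀`, no edge but the one at `t₀` changes the side.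
    have hind : ∀ j : ℕ, j ≤ m → (p (t₀ + 1 + (j : Fin (m + 1))) ↔ p (t₀ + 1)) := by
      intro j
      induction j with
      | zero => simp
      | succ j ih =>
        intro hj
        rw [← ih (by omega)]
        by_contra hne
        have hflip : p (t₀ + 1 + (j : Fin (m + 1))) ↔ ¬ p (t₀ + 1 + (j : Fin (m + 1)) + 1) := by
          rw [Nat.cast_succ, ← add_assoc] at hne
          tauto
        have := huniq _ hflip
        rw [add_assoc, add_eq_left] at this
        have h0 : ((j + 1 : ℕ) : Fin (m + 1)) = 0 := by
          rw [Nat.cast_succ, add_comm _ (1 : Fin (m + 1))]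
          exact this
        rw [Fin.natCast_eq_zero] at h0
        exact absurd (Nat.le_of_dvd (by omega) h0) (by omega)
    have hm := hind m le_rfl
    have hlast : t₀ + 1 + (m : Fin (m + 1)) = t₀ := by
      rw [add_assoc, add_eq_left, add_comm (1 : Fin (m + 1))]
      have := Fin.natCast_self (m + 1)
      rwa [Nat.cast_succ] at this
    rw [hlast] at hm
    tauto
  · push Not at hb
    have hsame : ∀ t, p t ↔ p 0 := by
      intro t
      induction t using Fin.induction with
      | zero => rfl
      | succ t ih =>
        rw [← ih, ← Fin.coeSucc_eq_succ]
        have := hb t.castSucc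
        tauto
    by_cases h0 : p 0
    · left
      refine ⟨m, x, i, hx, hedge, rfl, ?_⟩
      rintro _ ⟨t, rfl⟩
      have h1 := (hsame t).2 h0
      have h2 := (hsame (t + 1)).2 h0
      rcases hcase t with h | h | h
      · exact h.2.2
      · tauto
      · tauto
    · right
      refine ⟨m, x, i, hx, hedge, rfl, ?_⟩
      rintro _ ⟨t, rfl⟩
      have h1 := (not_congr (hsame t)).2 h0
      have h2 := (not_congr (hsame (t + 1))).2 h0
      rcases hcase t with h | h | h
      · tauto
      · exact h.2.2
      · tauto

theorem not_nodup_of_not_tangleFree_append {l l' : List (HalfEdge n d)}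
    (hdisj : ∀ e ∈ l, ∀ f ∈ l', e.1 ≠ f.1) (h : (pathGraph l).TangleFree)
    (h' : (pathGraph l').TangleFree) (hnot : ¬ (pathGraph (l ++ l')).TangleFree) :
    ¬ (l.map Prod.fst).Nodup ∧ ¬ (l'.map Prod.fst).Nodup := by
  rw [ColoredGraph.TangleFree] at hnot
  push Not at hnot
  obtain ⟨C, C', hC, hC', hne⟩ := hnot
  rcases isCycle_of_append hdisj hC with h1 | h1 <;> rcases isCycle_of_append hdisj hC' with h2 | h2
  · exact absurd (h _ _ h1 h2) hne
  · exact ⟨not_nodup_of_isCycle h1, not_nodup_of_isCycle h2⟩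
  · exact ⟨not_nodup_of_isCycle h2, not_nodup_of_isCycle h1⟩
  · exact absurd (h' _ _ h1 h2) hne

end Tangles

section Circuits

variable {n d : ℕ}

/-- The constraints on `σ₁, …, σ_d` under which a sequence of half-edges is a walk:
`σ_{i_t}(x_t) = x_{t+1}` for all `t`. -/
def walkConstraints {c : ℕ} (ζ : Fin (c + 1) → HalfEdge n d) : Finset (Fin d × Fin n × Fin n) :=
  Finset.univ.image fun t : Fin c =>
    constraintOf (ζ t.castSucc).1 (ζ t.castSucc).2 (ζ t.succ).1

/-- A circuit: a closed sequence of half-edges with pairwise distinct colored edges. The letter of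
the last half-edge is free. -/
def IsCircuit {c : ℕ} (ζ : Fin (c + 1) → HalfEdge n d) : Prop :=
  (ζ 0).1 = (ζ (Fin.last c)).1 ∧ (walkConstraints ζ).card = c

/-- Some segment of positive length is a circuit. -/
def ContainsCircuit {L : ℕ} (η : Fin (L + 1) → HalfEdge n d) : Prop :=
  ∃ (s c : ℕ) (h : s + (c + 1) ≤ L),
    IsCircuit (fun u : Fin (c + 1 + 1) => η ⟨s + u, by omega⟩)

/-- A shortest return of a non-backtracking path to a vertex is a circuit. Its vertices are
distinct, so that a repeated edge can only be an edge of a return of length two that is used in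
both directions, and this would be a backtracking. -/
theorem containsCircuit_of_not_injective {L : ℕ} {η : Fin (L + 1) → HalfEdge n d}
    (hnb : ∀ t : Fin L, (η t.castSucc).2 ≠ bar (η t.succ).2)
    (hη : ¬ Function.Injective fun t => (η t).1) : ContainsCircuit η := by
  classical
  have hex : ∃ c : ℕ, ∃ (s : ℕ) (h : s + (c + 1) ≤ L),
      (η ⟨s, by omega⟩).1 = (η ⟨s + (c + 1), by omega⟩).1 := by
    rw [Function.Injective] at hη
    push Not at hη
    obtain ⟨a, b, hab, hne⟩ := hη
    rcases lt_or_gt_of_ne (Fin.val_ne_of_ne hne) with h | h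
    · refine ⟨b - a - 1, a, by omega, hab.trans ?_⟩
      congr 2
      ext
      simp
      omega
    · refine ⟨a - b - 1, b, by omega, hab.symm.trans ?_⟩
      congr 2
      ext
      simp
      omega
  set c := Nat.find hex with hc
  obtain ⟨s, hs, heq⟩ := Nat.find_spec hex
  rw [← hc] at hs
  have hmin : ∀ (a b : ℕ) (ha : a < b) (hb : b ≤ L),
      (η ⟨a, by omega⟩).1 = (η ⟨b, by omega⟩).1 → c + 1 ≤ b - a := by
    intro a b ha hb hab
    have hle : c ≤ b - a - 1 := by
      refine Nat.find_min' hex ⟨a, by omega, hab.trans ?_⟩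
      congr 2
      ext
      simp
      omega
    omega
  refine ⟨s, c, hs, ?_, ?_⟩
  · simpa using heq
  · rw [walkConstraints, Finset.card_image_of_injective, Finset.card_fin]
    have hlt : ∀ a b : Fin (c + 1), a < b →
        constraintOf (η ⟨s + a, by omega⟩).1 (η ⟨s + a, by omega⟩).2
            (η ⟨s + (a + 1), by omega⟩).1 ≠
          constraintOf (η ⟨s + b, by omega⟩).1 (η ⟨s + b, by omega⟩).2
            (η ⟨s + (b + 1), by omega⟩).1 := by
      intro a b hab h
      have hab' : a.val < b.val := hab
      rcases constraintOf_eq_iff.1 h with ⟨h, -, -⟩ | ⟨h1, h2, h3⟩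
      · have := hmin _ _ (by omega) (by omega) h
        omega
      · have h4 := hmin _ _ (by omega) (by omega) h1
        have h5 : b.val = a.val + 1 := by
          by_contra hne
          have := hmin _ _ (by omega) (by omega) h3
          omega
        have h6 := hnb ⟨s + a, by omega⟩
        apply h6
        refine Eq.trans h2 ?_
        congr 3
        ext
        simp
        omega
    intro a b hab
    rcases lt_trichotomy a b with h | h | h
    · exact absurd hab (hlt a b h)
    · exact h
    · exact absurd hab.symm (hlt b a h)

end Circuits

/-! ### Weights of circuits -/

section Majorant

variable {n d : ℕ}

/-- The kernel `(S_i)_{xy} + 1/n` on half-edges `(x, i)`, `(y, j)`. It dominates the entries of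
`S_i` and of `S_i - 1/n`, and its rows and columns have sum `4d`. -/
noncomputable def majorant (σ : Fin d → Equiv.Perm (Fin n)) (e f : HalfEdge n d) : ℝ :=
  (if symPerm σ e.2 e.1 = f.1 then 1 else 0) + 1 / n

theorem majorant_nonneg (σ : Fin d → Equiv.Perm (Fin n)) (e f : HalfEdge n d) :
    0 ≤ majorant σ e f := by
  unfold majorant
  positivity

theorem norm_permEntry_le (σ : Fin d → Equiv.Perm (Fin n)) (e f : HalfEdge n d) :
    ‖permEntry σ e.2 e.1 f.1‖ ≤ majorant σ e f := by
  unfold permEntry majorant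
  split_ifs <;> simp

theorem norm_permEntryCentered_le (σ : Fin d → Equiv.Perm (Fin n)) (e f : HalfEdge n d) :
    ‖permEntryCentered σ e.2 e.1 f.1‖ ≤ majorant σ e f := by
  refine (norm_sub_le _ _).trans ?_
  unfold permEntry majorant
  split_ifs <;> simp

theorem card_color : Fintype.card (Color d) = 2 * d := by
  simp [Color, mul_comm]

theorem sum_majorant_row_le (σ : Fin d → Equiv.Perm (Fin n)) (e : HalfEdge n d) :
    ∑ f, majorant σ e f ≤ 4 * d := by
  have hn : (n : ℝ) ≠ 0 := Nat.cast_ne_zero.2 (Fin.pos e.1).ne'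
  rw [Fintype.sum_prod_type_right]
  simp only [majorant, Finset.sum_const, Finset.card_univ, card_color, nsmul_eq_mul,
    Finset.sum_add_distrib, Finset.sum_ite_eq, Finset.mem_univ, if_true, Fintype.card_fin]
  push_cast
  field_simp
  linarith

theorem sum_majorant_col_le (σ : Fin d → Equiv.Perm (Fin n)) (f : HalfEdge n d) :
    ∑ e, majorant σ e f ≤ 4 * d := by
  have hn : (n : ℝ) ≠ 0 := Nat.cast_ne_zero.2 (Fin.pos f.1).ne'
  rw [Fintype.sum_prod_type_right]
  have h : ∀ i : Color d, ∑ x, majorant σ (x, i) f = 2 := by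
    intro i
    simp only [majorant, Finset.sum_add_distrib, Finset.sum_const, Finset.card_univ,
      Fintype.card_fin, nsmul_eq_mul]
    rw [Equiv.sum_comp (symPerm σ i) (fun y => if y = f.1 then (1 : ℝ) else 0), Finset.sum_ite_eq']
    simp only [Finset.mem_univ, if_true]
    field_simp
    norm_num
  simp only [h, Finset.sum_const, Finset.card_univ, card_color, nsmul_eq_mul]
  push_cast
  linarith

theorem sum_halfEdge_vertex (z : Fin n) :
    ∑ e : HalfEdge n d, (if e.1 = z then (1 : ℝ) else 0) = 2 * d := by
  rw [Fintype.sum_prod_type_right]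
  simp only [Finset.sum_const, Finset.card_univ, card_color, nsmul_eq_mul,
    Finset.sum_ite_eq', Finset.mem_univ, if_true]
  push_cast
  ring

variable (σ : Fin d → Equiv.Perm (Fin n))

theorem sum_pathWeight_vertex_le {L : ℕ} (a : Fin (L + 1)) (z : Fin n) :
    ∑ η : Fin (L + 1) → HalfEdge n d, pathWeight (majorant σ) η * (if (η a).1 = z then 1 else 0) ≤
      2 * d * (4 * d) ^ L := by
  have h := sum_pathWeight_position_le (majorant_nonneg σ) (by positivity)
    (sum_majorant_row_le σ) (sum_majorant_col_le σ) a (fun e => if e.1 = z then 1 else 0)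
    fun e => by positivity
  rwa [sum_halfEdge_vertex] at h

theorem sum_pathWeight_vertex_le' {L : ℕ} (a : Fin (L + 1)) (z : Fin n) :
    ∑ η : Fin (L + 1) → HalfEdge n d, pathWeight (majorant σ) η * (if z = (η a).1 then 1 else 0) ≤
      2 * d * (4 * d) ^ L := by
  simpa only [eq_comm] using sum_pathWeight_vertex_le σ a z

theorem sum_pathWeight_le {L : ℕ} :
    ∑ η : Fin (L + 1) → HalfEdge n d, pathWeight (majorant σ) η ≤ 2 * d * n * (4 * d) ^ L := by
  have h := sum_pathWeight_position_le (majorant_nonneg σ) (by positivity)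
    (sum_majorant_row_le σ) (sum_majorant_col_le σ) (0 : Fin (L + 1)) (fun _ => 1)
    fun e => zero_le_one
  simp only [mul_one, Finset.sum_const, Finset.card_univ, Fintype.card_prod (Fin n) (Color d),
    card_color, Fintype.card_fin, nsmul_eq_mul] at h
  refine h.trans_eq ?_
  push_cast
  ring

/-- Two paths that meet at given times: once the first one is chosen, the second one has to pass
through a given vertex. -/
theorem sum_meeting_le {k L : ℕ} (a : Fin (k + 1)) (b : Fin (L + 1))
    (F : (Fin (k + 1) → HalfEdge n d) → ℝ) (hF : ∀ η, 0 ≤ F η) :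
    ∑ η, ∑ θ : Fin (L + 1) → HalfEdge n d, pathWeight (majorant σ) η * pathWeight (majorant σ) θ *
        (F η * if (η a).1 = (θ b).1 then 1 else 0) ≤
      (∑ η, pathWeight (majorant σ) η * F η) * (2 * d * (4 * d) ^ L) := by
  rw [Finset.sum_mul]
  refine Finset.sum_le_sum fun η _ => ?_
  have hη := mul_nonneg (pathWeight_nonneg (majorant_nonneg σ) η) (hF η)
  refine le_trans (le_of_eq ?_)
    (mul_le_mul_of_nonneg_left (sum_pathWeight_vertex_le' σ b (η a).1) hη)
  rw [Finset.mul_sum]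
  exact Finset.sum_congr rfl fun θ _ => by ring

theorem sum_meeting_le' {k L : ℕ} (a : Fin (k + 1)) (b : Fin (L + 1))
    (F : (Fin (L + 1) → HalfEdge n d) → ℝ) (hF : ∀ η, 0 ≤ F η) :
    ∑ η : Fin (k + 1) → HalfEdge n d, ∑ θ, pathWeight (majorant σ) η * pathWeight (majorant σ) θ *
        (F θ * if (η a).1 = (θ b).1 then 1 else 0) ≤
      (∑ η, pathWeight (majorant σ) η * F η) * (2 * d * (4 * d) ^ k) := by
  rw [Finset.sum_comm]
  refine le_trans (le_of_eq ?_) (sum_meeting_le σ b a F hF)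
  refine Finset.sum_congr rfl fun θ _ => Finset.sum_congr rfl fun η _ => ?_
  rw [mul_comm (pathWeight (majorant σ) η)]
  simp only [eq_comm]

/-- Closed sequences with one step of weight `1`: cutting at this step leaves two paths that
meet. -/
theorem sum_closed_prod_ne_le {M r : ℕ} (hr : r < M) :
    ∑ ζ : Fin (M + 1) → HalfEdge n d, (if (ζ 0).1 = (ζ (Fin.last M)).1 then 1 else 0) *
        ∏ t : Fin M with t.val ≠ r, majorant σ (ζ t.castSucc) (ζ t.succ) ≤
      n * ((2 * d) ^ 2 * (4 * d) ^ (M - 1)) := by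
  obtain ⟨L, rfl⟩ : ∃ L, M = r + 1 + L := ⟨M - (r + 1), by omega⟩
  have h := sum_pieces fun (η : Fin (r + 1) → HalfEdge n d) (θ : Fin (L + 1) → HalfEdge n d) =>
    pathWeight (majorant σ) η * pathWeight (majorant σ) θ *
        ((1 : ℝ) * if (η 0).1 = (θ (Fin.last L)).1 then 1 else 0)
  have h2 := sum_meeting_le σ (0 : Fin (r + 1)) (Fin.last L) (fun _ => 1) fun _ => zero_le_one
  rw [← h] at h2
  refine le_trans (le_of_eq ?_) (h2.trans ?_)
  · refine Finset.sum_congr rfl fun ζ _ => ?_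
    rw [prod_filter_ne_eq_pathWeight, one_mul, mul_comm]
    rfl
  · simp only [mul_one]
    refine (mul_le_mul_of_nonneg_right (sum_pathWeight_le σ) (by positivity)).trans_eq ?_
    rw [show r + 1 + L - 1 = r + L by omega, pow_add]
    ring

end Majorant

section CircuitWeights

open Classical

variable {n d : ℕ} (σ : Fin d → Equiv.Perm (Fin n))

theorem mem_satisfying_walkConstraints {c : ℕ} {ζ : Fin (c + 1) → HalfEdge n d} :
    σ ∈ satisfying (walkConstraints ζ) ↔
      ∀ t : Fin c, symPerm σ (ζ t.castSucc).2 (ζ t.castSucc).1 = (ζ t.succ).1 := by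
  simp only [mem_satisfying, walkConstraints, Finset.mem_image, Finset.mem_univ, true_and,
    forall_exists_index, forall_apply_eq_imp_iff, symPerm_apply_eq_iff]

theorem one_le_pathWeight_of_mem {c : ℕ} {ζ : Fin (c + 1) → HalfEdge n d}
    (h : σ ∈ satisfying (walkConstraints ζ)) : 1 ≤ pathWeight (majorant σ) ζ := by
  rw [mem_satisfying_walkConstraints] at h
  rw [pathWeight, ← Finset.prod_const_one (s := (Finset.univ : Finset (Fin c)))]
  refine Finset.prod_le_prod (fun _ _ => zero_le_one) fun t _ => ?_
  rw [majorant, if_pos (h t)]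
  simp

/-- The circuits of length `c` in the random graph of `σ`. -/
noncomputable def heldCircuits (c : ℕ) : Finset (Fin (c + 1) → HalfEdge n d) :=
  Finset.univ.filter fun ζ => IsCircuit ζ ∧ σ ∈ satisfying (walkConstraints ζ)

/-- Expansion of `∏ (a_i + b)` by the factors from which `b` is chosen: every term but
`∏ a_i` has some factor `b`, and is counted once for each of them. -/
theorem prod_add_const_le {ι : Type*} (s : Finset ι) (a : ι → ℝ) (ha : ∀ i, 0 ≤ a i) {b : ℝ}
    (hb : 0 ≤ b) :
    ∏ i ∈ s, (a i + b) ≤ ∏ i ∈ s, a i + ∑ r ∈ s, b * ∏ i ∈ s with i ≠ r, (a i + b) := by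
  induction s using Finset.induction_on with
  | empty => simp
  | insert j s hj ih =>
    have h1 : ∏ i ∈ insert j s with i ≠ j, (a i + b) = ∏ i ∈ s, (a i + b) := by
      rw [Finset.filter_ne', Finset.erase_insert hj]
    have h2 : ∀ r ∈ s, ∏ i ∈ insert j s with i ≠ r, (a i + b) =
        (a j + b) * ∏ i ∈ s with i ≠ r, (a i + b) := by
      intro r hr
      have hjr : j ≠ r := fun h => hj (h ▸ hr)
      rw [Finset.filter_insert, if_pos hjr, Finset.prod_insert]
      simp [hj]
    have h3 : ∀ r ∈ s, b * (a j * ∏ i ∈ s with i ≠ r, (a i + b)) ≤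
        b * ∏ i ∈ insert j s with i ≠ r, (a i + b) := by
      intro r hr
      rw [h2 r hr]
      have := ha j
      have : 0 ≤ ∏ i ∈ s with i ≠ r, (a i + b) :=
        Finset.prod_nonneg fun i _ => add_nonneg (ha i) hb
      gcongr
      linarith
    rw [Finset.prod_insert hj, Finset.prod_insert hj, Finset.sum_insert hj, h1]
    have h4 := Finset.sum_le_sum h3
    have h5 := mul_le_mul_of_nonneg_left ih (ha j)
    rw [mul_add, Finset.mul_sum] at h5
    have h6 : ∑ r ∈ s, a j * (b * ∏ i ∈ s with i ≠ r, (a i + b)) =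
        ∑ r ∈ s, b * (a j * ∏ i ∈ s with i ≠ r, (a i + b)) :=
      Finset.sum_congr rfl fun _ _ => by ring
    rw [h6] at h5
    rw [add_mul]
    linarith

/-- The total weight of circuits of length `c + 1`, for weights `S + 1/n`, is the number of circuits
in the random graph up to a bounded error: in a circuit with a step of weight `1/n`, that weight
compensates for the choice of the starting vertex. -/
theorem sum_circuit_weight_le (hn : 0 < n) (c : ℕ) :
    ∑ ζ : Fin (c + 1 + 1) → HalfEdge n d, pathWeight (majorant σ) ζ *
        (if IsCircuit ζ then 1 else 0) ≤
      (heldCircuits σ (c + 1)).card + (c + 1) * ((2 * d) ^ 2 * (4 * d) ^ c) := by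
  have hn' : (0 : ℝ) < n := Nat.cast_pos.2 hn
  have hpt : ∀ ζ : Fin (c + 1 + 1) → HalfEdge n d,
      pathWeight (majorant σ) ζ * (if IsCircuit ζ then 1 else 0) ≤
        (if IsCircuit ζ ∧ σ ∈ satisfying (walkConstraints ζ) then 1 else 0) +
        ∑ r : Fin (c + 1), 1 / (n : ℝ) *
          ((if (ζ 0).1 = (ζ (Fin.last (c + 1))).1 then 1 else 0) *
            ∏ t : Fin (c + 1) with t.val ≠ r.val, majorant σ (ζ t.castSucc) (ζ t.succ)) := by
    intro ζ
    have hprod : ∀ r : Fin (c + 1), 0 ≤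
        ∏ t : Fin (c + 1) with t.val ≠ r.val, majorant σ (ζ t.castSucc) (ζ t.succ) :=
      fun r => Finset.prod_nonneg fun t _ => majorant_nonneg σ _ _
    by_cases hζ : IsCircuit ζ
    · have h := prod_add_const_le Finset.univ (fun t : Fin (c + 1) =>
        if symPerm σ (ζ t.castSucc).2 (ζ t.castSucc).1 = (ζ t.succ).1 then (1 : ℝ) else 0)
        (fun t => by positivity) (b := 1 / (n : ℝ)) (by positivity)
      simp only [hζ, if_true, mul_one, true_and, mem_satisfying_walkConstraints, hζ.1, one_mul]
      rw [Finset.prod_boole] at h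
      simp only [Finset.mem_univ, true_imp_iff] at h
      refine h.trans (le_of_eq ?_)
      congr 1
      refine Finset.sum_congr rfl fun r _ => ?_
      congr 1
      refine Finset.prod_congr ?_ fun _ _ => rfl
      ext t
      simp [Fin.ext_iff]
    · simp only [hζ, if_false, mul_zero, false_and, zero_add]
      exact Finset.sum_nonneg fun r _ => mul_nonneg (by positivity)
        (mul_nonneg (by positivity) (hprod r))
  refine (Finset.sum_le_sum fun ζ _ => hpt ζ).trans ?_
  rw [Finset.sum_add_distrib]
  refine add_le_add (le_of_eq ?_) ?_
  · rw [heldCircuits, Finset.card_filter]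
    push_cast
    rfl
  · rw [Finset.sum_comm]
    refine (Finset.sum_le_card_nsmul _ _ ((2 * d) ^ 2 * (4 * d) ^ c : ℝ) fun r _ => ?_).trans_eq ?_
    · rw [← Finset.mul_sum]
      refine (mul_le_mul_of_nonneg_left (sum_closed_prod_ne_le σ r.2) (by positivity)).trans_eq ?_
      rw [Nat.add_sub_cancel]
      field_simp
    · simp

/-- The circuits of length at most `ℓ` in the random graph of `σ`. -/
noncomputable def circuits (ℓ : ℕ) : Finset (Σ c : Fin ℓ, (Fin (c.val + 1 + 1) → HalfEdge n d)) :=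
  Finset.univ.sigma fun c => heldCircuits σ (c.val + 1)

/-- The weight of paths that contain a circuit: the steps outside the circuit are summed out, at a
cost of `4d` for each. -/
theorem sum_containsCircuit_weight_le (hn : 0 < n) (hd : 0 < d) {L ℓ : ℕ} (hL : L ≤ ℓ) :
    ∑ η : Fin (L + 1) → HalfEdge n d,
        pathWeight (majorant σ) η * (if ContainsCircuit η then 1 else 0) ≤
      ℓ * (4 * d) ^ ℓ * ((circuits σ ℓ).card + ℓ ^ 2 * ((2 * d) ^ 2 * (4 * d) ^ ℓ)) := by
  have hd1 : (1 : ℝ) ≤ 4 * d := by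
    have : (1 : ℝ) ≤ d := Nat.one_le_cast.2 hd
    linarith
  have hw := fun η : Fin (L + 1) → HalfEdge n d => pathWeight_nonneg (majorant_nonneg σ) η
  set f : Fin ℓ → Fin ℓ → (Fin (L + 1) → HalfEdge n d) → ℝ := fun s c η =>
    if h : s.val + (c.val + 1) ≤ L then
      (if IsCircuit (fun u : Fin (c.val + 1 + 1) => η ⟨s + u, by omega⟩) then 1 else 0) else 0
    with hf
  have hf0 : ∀ s c η, 0 ≤ f s c η := by
    intro s c η
    simp only [hf]
    split_ifs <;> simp
  have hpt : ∀ η : Fin (L + 1) → HalfEdge n d,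
      pathWeight (majorant σ) η * (if ContainsCircuit η then 1 else 0) ≤
        ∑ s, ∑ c, pathWeight (majorant σ) η * f s c η := by
    intro η
    by_cases hη : ContainsCircuit η
    · obtain ⟨s, c, h, hc⟩ := id hη
      have h1 : f ⟨s, by omega⟩ ⟨c, by omega⟩ η = 1 := by
        simp only [hf]
        rw [dif_pos h, if_pos hc]
      rw [if_pos hη, ← h1]
      refine le_trans ?_ (Finset.single_le_sum (fun s _ => Finset.sum_nonneg fun c _ =>
        mul_nonneg (hw η) (hf0 s c η)) (Finset.mem_univ (⟨s, by omega⟩ : Fin ℓ)))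
      exact Finset.single_le_sum (f := fun c => pathWeight (majorant σ) η * f ⟨s, by omega⟩ c η)
        (fun c _ => mul_nonneg (hw η) (hf0 _ c η)) (Finset.mem_univ (⟨c, by omega⟩ : Fin ℓ))
    · rw [if_neg hη, mul_zero]
      exact Finset.sum_nonneg fun s _ => Finset.sum_nonneg fun c _ =>
        mul_nonneg (hw η) (hf0 s c η)
  have hsc : ∀ s c : Fin ℓ, ∑ η, pathWeight (majorant σ) η * f s c η ≤
      (4 * d) ^ ℓ * ((heldCircuits σ (c.val + 1)).card + ℓ * ((2 * d) ^ 2 * (4 * d) ^ ℓ)) := by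
    intro s c
    by_cases h : s.val + (c.val + 1) ≤ L
    · have h1 := sum_pathWeight_segment_le (majorant_nonneg σ) (by positivity)
        (sum_majorant_row_le σ) (sum_majorant_col_le σ) h
        (fun ζ => if IsCircuit ζ then 1 else 0) fun ζ => by positivity
      simp only [hf, dif_pos h]
      refine h1.trans ?_
      have h2 := sum_circuit_weight_le σ hn c.val
      have h3 : ((c.val : ℝ) + 1) ≤ ℓ := by exact_mod_cast c.2
      have h4 : c.val ≤ ℓ := c.2.le
      have h5 : L - (c.val + 1) ≤ ℓ := by omega
      refine mul_le_mul (pow_le_pow_right₀ hd1 h5) (h2.trans ?_) ?_ (by positivity)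
      · gcongr
      · exact Finset.sum_nonneg fun ζ _ => mul_nonneg
          (pathWeight_nonneg (majorant_nonneg σ) ζ) (by positivity)
    · simp only [hf, dif_neg h, mul_zero, Finset.sum_const_zero]
      positivity
  refine (Finset.sum_le_sum fun η _ => hpt η).trans ?_
  rw [Finset.sum_comm]
  have h1 : ∀ s : Fin ℓ, ∑ η, ∑ c, pathWeight (majorant σ) η * f s c η ≤
      (4 * d) ^ ℓ * ((circuits σ ℓ).card + ℓ ^ 2 * ((2 * d) ^ 2 * (4 * d) ^ ℓ)) := by
    intro s
    rw [Finset.sum_comm]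
    refine (Finset.sum_le_sum fun c _ => hsc s c).trans_eq ?_
    rw [← Finset.mul_sum, Finset.sum_add_distrib, circuits, Finset.card_sigma]
    simp only [Finset.sum_const, Finset.card_univ, Fintype.card_fin, nsmul_eq_mul]
    push_cast
    ring
  refine (Finset.sum_le_card_nsmul _ _ _ fun s _ => h1 s).trans_eq ?_
  simp only [Finset.card_univ, Fintype.card_fin, nsmul_eq_mul]
  ring

end CircuitWeights

/-! ### The number of circuits -/

section CircuitCount

open Classical

variable {n d : ℕ}

/-- The set of vertices visited by a sequence of half-edges. -/
def walkVerts {c : ℕ} (ζ : Fin (c + 1) → HalfEdge n d) : Finset (Fin n) :=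
  Finset.univ.image fun t => (ζ t).1

theorem card_walkVerts_le {c : ℕ} (ζ : Fin (c + 1) → HalfEdge n d) :
    (walkVerts ζ).card ≤ c + 1 :=
  Finset.card_image_le.trans_eq (Finset.card_fin _)

theorem constraint_mem_walkVerts {c : ℕ} {ζ : Fin (c + 1) → HalfEdge n d}
    {e : Fin d × Fin n × Fin n} (he : e ∈ walkConstraints ζ) : e.2.1 ∈ walkVerts ζ := by
  obtain ⟨t, -, rfl⟩ := Finset.mem_image.1 he
  rw [constraintOf]
  split_ifs
  · exact Finset.mem_image_of_mem (fun t => (ζ t).1) (Finset.mem_univ _)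
  · exact Finset.mem_image_of_mem (fun t => (ζ t).1) (Finset.mem_univ _)

/-- Since the permutations determine a walk from its letters and one of its vertices, few circuits
pass through a given vertex. -/
theorem card_heldCircuits_vertex_le (σ : Fin d → Equiv.Perm (Fin n)) (c : ℕ) (z : Fin n) :
    ((heldCircuits σ c).filter fun ζ => z ∈ walkVerts ζ).card ≤
      (c + 1) * (2 * d * (4 * d) ^ c) := by
  have hw := fun η : Fin (c + 1) → HalfEdge n d => pathWeight_nonneg (majorant_nonneg σ) η
  have h1 : (((heldCircuits σ c).filter fun ζ => z ∈ walkVerts ζ).card : ℝ) ≤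
      ∑ ζ : Fin (c + 1) → HalfEdge n d, ∑ a : Fin (c + 1),
        pathWeight (majorant σ) ζ * (if (ζ a).1 = z then 1 else 0) := by
    rw [Finset.cast_card]
    refine le_trans (Finset.sum_le_sum fun ζ hζ => ?_) (Finset.sum_le_sum_of_subset_of_nonneg
      (Finset.subset_univ _) fun ζ _ _ => Finset.sum_nonneg fun a _ =>
        mul_nonneg (hw ζ) (by positivity))
    obtain ⟨hζ, hz⟩ := Finset.mem_filter.1 hζ
    obtain ⟨a, -, ha⟩ := Finset.mem_image.1 hz
    refine le_trans ?_ (Finset.single_le_sum (fun a _ => mul_nonneg (hw ζ) (by positivity))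
      (Finset.mem_univ a))
    rw [if_pos ha, mul_one]
    exact one_le_pathWeight_of_mem σ (Finset.mem_filter.1 hζ).2.2
  have h2 : (((heldCircuits σ c).filter fun ζ => z ∈ walkVerts ζ).card : ℝ) ≤
      ((c + 1) * (2 * d * (4 * d) ^ c) : ℕ) := by
    refine h1.trans ?_
    rw [Finset.sum_comm]
    refine (Finset.sum_le_card_nsmul _ _ _ fun a _ => sum_pathWeight_vertex_le σ a z).trans_eq ?_
    simp
  exact_mod_cast h2

theorem card_circuits_not_disjoint_le (σ : Fin d → Equiv.Perm (Fin n)) (hd : 0 < d) (ℓ : ℕ)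
    (U : Finset (Fin n)) :
    ((circuits σ ℓ).filter fun κ => ¬ Disjoint (walkVerts κ.2) U).card ≤
      U.card * (ℓ * ((ℓ + 1) * (2 * d * (4 * d) ^ ℓ))) := by
  have h1 : ((circuits σ ℓ).filter fun κ => ¬ Disjoint (walkVerts κ.2) U) ⊆
      U.biUnion fun z => (circuits σ ℓ).filter fun κ => z ∈ walkVerts κ.2 := by
    intro κ hκ
    obtain ⟨hκ, hU⟩ := Finset.mem_filter.1 hκ
    obtain ⟨z, hz, hzU⟩ := Finset.not_disjoint_iff.1 hU
    exact Finset.mem_biUnion.2 ⟨z, hzU, Finset.mem_filter.2 ⟨hκ, hz⟩⟩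
  refine (Finset.card_le_card h1).trans (Finset.card_biUnion_le_card_mul _ _ _ fun z _ => ?_)
  have h2 : ((circuits σ ℓ).filter fun κ => z ∈ walkVerts κ.2) =
      Finset.univ.sigma fun c : Fin ℓ =>
        (heldCircuits σ (c.val + 1)).filter fun ζ => z ∈ walkVerts ζ := by
    ext κ
    simp [circuits]
  rw [h2, Finset.card_sigma]
  refine (Finset.sum_le_card_nsmul _ _ ((ℓ + 1) * (2 * d * (4 * d) ^ ℓ)) fun c _ => ?_).trans_eq ?_
  · refine (card_heldCircuits_vertex_le σ (c.val + 1) z).trans ?_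
    have h3 : c.val + 1 ≤ ℓ := c.2
    have h4 : (4 * d) ^ (c.val + 1) ≤ (4 * d) ^ ℓ := Nat.pow_le_pow_right (by omega) h3
    gcongr
  · simp

/-- The number of `m`-tuples of circuits of length at most `ℓ` in the random graph of `σ` that have
pairwise disjoint sets of vertices, disjoint from `U`. -/
noncomputable def disjointTuples (σ : Fin d → Equiv.Perm (Fin n)) (ℓ : ℕ) :
    ℕ → Finset (Fin n) → ℕ
  | 0, _ => 1
  | m + 1, U => ∑ κ ∈ (circuits σ ℓ).filter fun κ => Disjoint (walkVerts κ.2) U,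
      disjointTuples σ ℓ m (U ∪ walkVerts κ.2)

/-- Many circuits give many tuples of disjoint circuits, each choice excluding few others. -/
theorem pow_le_disjointTuples (σ : Fin d → Equiv.Perm (Fin n)) (hd : 0 < d) (ℓ m : ℕ)
    (U : Finset (Fin n)) :
    ((circuits σ ℓ).card - (U.card + m * (ℓ + 1)) * (ℓ * ((ℓ + 1) * (2 * d * (4 * d) ^ ℓ)))) ^ m ≤
      disjointTuples σ ℓ m U := by
  set D := ℓ * ((ℓ + 1) * (2 * d * (4 * d) ^ ℓ)) with hD
  induction m generalizing U with
  | zero => simp [disjointTuples]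
  | succ m ih =>
    rw [disjointTuples]
    have h1 : ∀ κ ∈ (circuits σ ℓ).filter fun κ => Disjoint (walkVerts κ.2) U,
        ((circuits σ ℓ).card - (U.card + (m + 1) * (ℓ + 1)) * D) ^ m ≤
          disjointTuples σ ℓ m (U ∪ walkVerts κ.2) := by
      intro κ _
      refine le_trans (Nat.pow_le_pow_left (Nat.sub_le_sub_left (Nat.mul_le_mul_right _ ?_) _) m)
        (ih (U ∪ walkVerts κ.2))
      have h2 := Finset.card_union_le U (walkVerts κ.2)
      have h3 := card_walkVerts_le κ.2
      have h4 := κ.1.2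
      have h5 : (m + 1) * (ℓ + 1) = m * (ℓ + 1) + (ℓ + 1) := by ring
      omega
    refine le_trans ?_ (Finset.card_nsmul_le_sum _ _ _ h1)
    rw [smul_eq_mul, pow_succ']
    refine Nat.mul_le_mul_right _ ?_
    have h2 := card_circuits_not_disjoint_le σ hd ℓ U
    have h3 := Finset.card_filter_add_card_filter_not (s := circuits σ ℓ)
      fun κ => Disjoint (walkVerts κ.2) U
    rw [← hD] at h2
    have h4 : U.card * D ≤ (U.card + (m + 1) * (ℓ + 1)) * D :=
      Nat.mul_le_mul_right _ (Nat.le_add_right _ _)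
    omega

theorem card_closed_le (c : ℕ) :
    (Finset.univ.filter fun ζ : Fin (c + 1 + 1) → HalfEdge n d =>
      (ζ 0).1 = (ζ (Fin.last (c + 1))).1).card ≤ n ^ (c + 1) * (2 * d) ^ (c + 2) := by
  have h := Finset.card_le_card_of_injOn
    (s := Finset.univ.filter fun ζ : Fin (c + 1 + 1) → HalfEdge n d =>
      (ζ 0).1 = (ζ (Fin.last (c + 1))).1)
    (t := (Finset.univ : Finset ((Fin (c + 1) → HalfEdge n d) × Color d)))
    (fun ζ => (fun t => ζ t.castSucc, (ζ (Fin.last (c + 1))).2)) (fun _ _ => Finset.mem_univ _) ?_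
  · refine h.trans_eq ?_
    rw [Finset.card_univ, Fintype.card_prod, Fintype.card_fun, Fintype.card_prod (Fin n) (Color d),
      card_color]
    simp only [Fintype.card_fin]
    ring
  · intro ζ hζ ζ' hζ' h
    simp only [Finset.coe_filter, Finset.mem_univ, true_and, Set.mem_ofPred_eq] at hζ hζ'
    simp only [Prod.mk.injEq] at h
    have h0 : ∀ t : Fin (c + 1), ζ t.castSucc = ζ' t.castSucc := congrFun h.1
    funext t
    refine Fin.lastCases (Prod.ext ?_ h.2) h0 t
    rw [← hζ, ← hζ']
    exact congrArg Prod.fst (h0 0)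

/-- The expected number of tuples of disjoint circuits: a closed sequence of length `c` is a circuit
with conditional probability at most `(2/n) ^ c`, and there are at most `n ^ c * (2d) ^ (c + 1)`
of them. -/
theorem sum_disjointTuples_le (hn : 0 < n) (hd : 0 < d) (ℓ m : ℕ) (U : Finset (Fin n))
    (E : Finset (Fin d × Fin n × Fin n)) (hEU : ∀ e ∈ E, e.2.1 ∈ U)
    (hE : 2 * (E.card + m * ℓ) ≤ n) :
    ∑ σ ∈ satisfying E, (disjointTuples σ ℓ m U : ℝ) ≤
      (2 / n) ^ E.card * Fintype.card (Fin d → Equiv.Perm (Fin n)) *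
        (ℓ * (2 * d * (4 * d) ^ ℓ)) ^ m := by
  have hn' : (0 : ℝ) < n := Nat.cast_pos.2 hn
  have hd1 : (1 : ℝ) ≤ 4 * d := by
    have : (1 : ℝ) ≤ d := Nat.one_le_cast.2 hd
    linarith
  induction m generalizing U E with
  | zero =>
    have h : ((satisfying E).card : ℝ) * n ^ E.card ≤
        2 ^ E.card * Fintype.card (Fin d → Equiv.Perm (Fin n)) := by
      exact_mod_cast card_satisfying_le E (by omega)
    simp only [disjointTuples, Nat.cast_one, Finset.sum_const, nsmul_eq_mul, mul_one, pow_zero]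
    rw [div_pow, div_mul_eq_mul_div, le_div_iff₀ (by positivity)]
    exact h
  | succ m ih =>
    set X : ℝ := (2 / n) ^ E.card * Fintype.card (Fin d → Equiv.Perm (Fin n)) *
      (ℓ * (2 * d * (4 * d) ^ ℓ)) ^ m with hX
    have hX0 : 0 ≤ X := by positivity
    have hpt : ∀ (c : Fin ℓ) (ζ : Fin (c.val + 1 + 1) → HalfEdge n d),
        ∑ σ ∈ satisfying E, (if ζ ∈ heldCircuits σ (c.val + 1) ∧ Disjoint (walkVerts ζ) U then
          (disjointTuples σ ℓ m (U ∪ walkVerts ζ) : ℝ) else 0) ≤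
        (if (ζ 0).1 = (ζ (Fin.last (c.val + 1))).1 then 1 else 0) *
          ((2 / n) ^ (c.val + 1) * X) := by
      intro c ζ
      by_cases hζ : IsCircuit ζ ∧ Disjoint (walkVerts ζ) U
      · obtain ⟨⟨hcl, hcard⟩, hdisj⟩ := hζ
        have hdis : Disjoint E (walkConstraints ζ) := by
          rw [Finset.disjoint_left]
          intro e he he'
          exact Finset.disjoint_left.1 hdisj (constraint_mem_walkVerts he') (hEU e he)
        have hc : (E ∪ walkConstraints ζ).card = E.card + (c.val + 1) := by
          rw [Finset.card_union_of_disjoint hdis, hcard]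
        have h1 := ih (U ∪ walkVerts ζ) (E ∪ walkConstraints ζ) (by
          intro e he
          rcases Finset.mem_union.1 he with he | he
          · exact Finset.mem_union_left _ (hEU e he)
          · exact Finset.mem_union_right _ (constraint_mem_walkVerts he)) (by
          rw [hc]
          have h2 : (m + 1) * ℓ = m * ℓ + ℓ := by ring
          have h3 := c.2
          omega)
        rw [if_pos hcl, one_mul]
        refine le_trans (le_of_eq ?_) (h1.trans_eq ?_)
        · rw [← Finset.sum_filter]
          refine Finset.sum_congr ?_ fun _ _ => rfl
          ext σ
          simp only [Finset.mem_filter, mem_satisfying, heldCircuits, Finset.mem_univ, true_and,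
            Finset.mem_union]
          constructor
          · rintro ⟨h, ⟨-, h'⟩, -⟩ e (he | he)
            · exact h e he
            · exact h' e he
          · exact fun h => ⟨fun e he => h e (Or.inl he), ⟨⟨hcl, hcard⟩, fun e he => h e (Or.inr
              he)⟩,
              hdisj⟩
        · rw [hc, hX, pow_add]
          ring
      · refine le_trans (le_of_eq (Finset.sum_eq_zero fun σ _ => if_neg ?_)) (by positivity)
        rintro ⟨h, h'⟩
        exact hζ ⟨(Finset.mem_filter.1 h).2.1, h'⟩
    have hc : ∀ c : Fin ℓ, ∑ ζ : Fin (c.val + 1 + 1) → HalfEdge n d,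
        (if (ζ 0).1 = (ζ (Fin.last (c.val + 1))).1 then 1 else 0) * ((2 / n) ^ (c.val + 1) * X) ≤
        2 * d * (4 * d) ^ ℓ * X := by
      intro c
      rw [← Finset.sum_mul]
      have h1 : (∑ ζ : Fin (c.val + 1 + 1) → HalfEdge n d,
          if (ζ 0).1 = (ζ (Fin.last (c.val + 1))).1 then (1 : ℝ) else 0) ≤
          n ^ (c.val + 1) * (2 * d) ^ (c.val + 2) := by
        rw [Finset.sum_boole]
        exact_mod_cast card_closed_le c.val
      have h2 : (4 * d : ℝ) ^ (c.val + 1) ≤ (4 * d) ^ ℓ := pow_le_pow_right₀ hd1 c.2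
      calc _ ≤ n ^ (c.val + 1) * (2 * d) ^ (c.val + 2) * ((2 / n) ^ (c.val + 1) * X) := by gcongr
        _ = 2 * d * (4 * d : ℝ) ^ (c.val + 1) * X := by
          rw [div_pow, show (4 * d : ℝ) = 2 * (2 * d) by ring, mul_pow 2 (2 * d : ℝ)]
          field_simp
          ring
        _ ≤ _ := by gcongr
    have hsplit : ∀ σ, (disjointTuples σ ℓ (m + 1) U : ℝ) =
        ∑ c : Fin ℓ, ∑ ζ : Fin (c.val + 1 + 1) → HalfEdge n d,
          if ζ ∈ heldCircuits σ (c.val + 1) ∧ Disjoint (walkVerts ζ) U then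
            (disjointTuples σ ℓ m (U ∪ walkVerts ζ) : ℝ) else 0 := by
      intro σ
      rw [disjointTuples, Nat.cast_sum, Finset.sum_filter, circuits, Finset.sum_sigma]
      refine Finset.sum_congr rfl fun c _ => ?_
      simp only [ite_and]
      rw [Finset.sum_ite_mem, Finset.univ_inter]
    calc ∑ σ ∈ satisfying E, (disjointTuples σ ℓ (m + 1) U : ℝ)
        = ∑ c : Fin ℓ, ∑ ζ : Fin (c.val + 1 + 1) → HalfEdge n d, ∑ σ ∈ satisfying E,
          (if ζ ∈ heldCircuits σ (c.val + 1) ∧ Disjoint (walkVerts ζ) U then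
            (disjointTuples σ ℓ m (U ∪ walkVerts ζ) : ℝ) else 0) := by
          rw [Finset.sum_congr rfl fun σ _ => hsplit σ, Finset.sum_comm]
          exact Finset.sum_congr rfl fun c _ => Finset.sum_comm
      _ ≤ ∑ c : Fin ℓ, 2 * d * (4 * d) ^ ℓ * X :=
          Finset.sum_le_sum fun c _ => (Finset.sum_le_sum fun ζ _ => hpt c ζ).trans (hc c)
      _ = _ := by
          simp only [Finset.sum_const, Finset.card_univ, Fintype.card_fin, nsmul_eq_mul, hX]
          ring

/-- The threshold for the number of circuits of length at most `ℓ`, at which the bound on tuples of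
`m` disjoint circuits gives a probability of at most `3 ^ (-m)`. -/
def circuitThreshold (d ℓ m : ℕ) : ℕ :=
  3 * (ℓ * (2 * d * (4 * d) ^ ℓ)) + m * (ℓ + 1) * (ℓ * ((ℓ + 1) * (2 * d * (4 * d) ^ ℓ)))

/-- Markov's inequality for the number of `m`-tuples of disjoint circuits. -/
theorem card_many_circuits_le (hn : 0 < n) (hd : 0 < d) {ℓ m : ℕ} (hℓ : 0 < ℓ)
    (hm : 2 * (m * ℓ) ≤ n) :
    ((Finset.univ.filter fun σ : Fin d → Equiv.Perm (Fin n) =>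
        circuitThreshold d ℓ m ≤ (circuits σ ℓ).card).card : ℝ) * 3 ^ m ≤
      Fintype.card (Fin d → Equiv.Perm (Fin n)) := by
  set G : ℝ := ℓ * (2 * d * (4 * d) ^ ℓ) with hG
  have hG0 : 0 < G := by positivity
  have h1 := sum_disjointTuples_le hn hd ℓ m ∅ ∅ (by simp) (by simpa using hm)
  have h2 : (satisfying (∅ : Finset (Fin d × Fin n × Fin n))) = Finset.univ := by
    simp [satisfying]
  rw [h2, Finset.card_empty, pow_zero, one_mul] at h1
  have h3 : ((Finset.univ.filter fun σ : Fin d → Equiv.Perm (Fin n) =>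
        circuitThreshold d ℓ m ≤ (circuits σ ℓ).card).card : ℝ) * (3 * G) ^ m ≤
      ∑ σ : Fin d → Equiv.Perm (Fin n), (disjointTuples σ ℓ m ∅ : ℝ) := by
    rw [← nsmul_eq_mul]
    refine le_trans (Finset.card_nsmul_le_sum _ _ _ fun σ hσ => ?_)
      (Finset.sum_le_sum_of_subset_of_nonneg (Finset.subset_univ _) fun _ _ _ => by positivity)
    have h4 := (Finset.mem_filter.1 hσ).2
    have h5 : (3 * (ℓ * (2 * d * (4 * d) ^ ℓ))) ^ m ≤ disjointTuples σ ℓ m ∅ := by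
      refine le_trans (Nat.pow_le_pow_left ?_ m) (pow_le_disjointTuples σ hd ℓ m ∅)
      rw [Finset.card_empty, zero_add]
      rw [circuitThreshold] at h4
      exact Nat.le_sub_of_add_le h4
    rw [hG]
    exact_mod_cast h5
  have h6 := h3.trans h1
  rw [mul_pow, ← mul_assoc] at h6
  exact le_of_mul_le_mul_right h6 (by positivity)

/-- In the random graph, a circuit is determined by its first vertex and its letters. -/
theorem card_circuits_le (σ : Fin d → Equiv.Perm (Fin n)) (hd : 0 < d) (ℓ : ℕ) :
    (circuits σ ℓ).card ≤ n * (ℓ * (2 * d * (4 * d) ^ ℓ)) := by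
  rw [circuits, Finset.card_sigma]
  refine (Finset.sum_le_card_nsmul _ _ (2 * d * n * (4 * d) ^ ℓ) fun c _ => ?_).trans_eq ?_
  · have h1 : ((heldCircuits σ (c.val + 1)).card : ℝ) ≤
        ∑ ζ : Fin (c.val + 1 + 1) → HalfEdge n d, pathWeight (majorant σ) ζ := by
      rw [Finset.cast_card]
      exact le_trans (Finset.sum_le_sum fun ζ hζ =>
        one_le_pathWeight_of_mem σ (Finset.mem_filter.1 hζ).2.2)
        (Finset.sum_le_sum_of_subset_of_nonneg (Finset.subset_univ _) fun ζ _ _ =>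
          pathWeight_nonneg (majorant_nonneg σ) ζ)
    have h2 : (heldCircuits σ (c.val + 1)).card ≤ 2 * d * n * (4 * d) ^ (c.val + 1) := by
      exact_mod_cast h1.trans (sum_pathWeight_le σ)
    refine h2.trans (Nat.mul_le_mul_left _ (Nat.pow_le_pow_right (by omega) c.2))
  · simp only [Finset.card_univ, Fintype.card_fin, smul_eq_mul]
    ring

end CircuitCount

/-! ### Weights of tangled paths -/

section BadPaths

open Classical

variable {n d : ℕ}

/-- The two ways in which a path with tangle-free pieces can be tangled: the pieces have a common
vertex, or each of them contains a circuit. -/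
def PiecesTangled {k L : ℕ} (η : Fin (k + 1) → HalfEdge n d) (θ : Fin (L + 1) → HalfEdge n d) :
    Prop :=
  (∃ a b, (η a).1 = (θ b).1) ∨ (ContainsCircuit η ∧ ContainsCircuit θ)

theorem take_ofFn_eq {H : Type*} {k L : ℕ} (γ : Fin (k + 1 + L + 1) → H) :
    (List.ofFn γ).take (k + 1) = List.ofFn (firstPiece γ) := by
  refine List.ext_getElem (by simp; omega) fun t h1 h2 => ?_
  rw [List.getElem_take, List.getElem_ofFn, List.getElem_ofFn]
  rfl

theorem drop_ofFn_eq {H : Type*} {k L : ℕ} (γ : Fin (k + 1 + L + 1) → H) :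
    (List.ofFn γ).drop (k + 1) = List.ofFn (secondPiece γ) := by
  refine List.ext_getElem (by simp; omega) fun t h1 h2 => ?_
  rw [List.getElem_drop, List.getElem_ofFn, List.getElem_ofFn]
  rfl

theorem containsCircuit_of_not_nodup {L : ℕ} {η : Fin (L + 1) → HalfEdge n d}
    (hnb : NonBacktracking (List.ofFn η)) (h : ¬ ((List.ofFn η).map Prod.fst).Nodup) :
    ContainsCircuit η := by
  refine containsCircuit_of_not_injective (fun t => ?_) fun hinj => h ?_
  · have := List.isChain_iff_getElem.1 hnb t.val (by simp)
    rw [List.getElem_ofFn, List.getElem_ofFn] at this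
    exact this
  · rw [List.map_ofFn, List.nodup_ofFn]
    exact hinj

theorem piecesTangled_of_memFk {k L : ℕ} {γ : Fin (k + 1 + L + 1) → HalfEdge n d}
    (h : MemFk (k + 1) (List.ofFn γ)) (hnot : ¬ MemF (List.ofFn γ)) :
    PiecesTangled (firstPiece γ) (secondPiece γ) := by
  obtain ⟨hnb, h1, h2⟩ := h
  have h3 : ¬ (pathGraph (List.ofFn γ)).TangleFree := fun h3 => hnot ⟨hnb, h3⟩
  by_cases hmeet : ∃ a b, (firstPiece γ a).1 = (secondPiece γ b).1
  · exact Or.inl hmeet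
  · right
    push Not at hmeet
    have hsplit := List.take_append_drop (k + 1) (List.ofFn γ)
    rw [NonBacktracking, ← hsplit, List.isChain_append] at hnb
    rw [← hsplit] at h3
    rw [take_ofFn_eq, drop_ofFn_eq] at *
    have h4 := not_nodup_of_not_tangleFree_append (by
      intro e he f hf
      obtain ⟨a, rfl⟩ := List.mem_ofFn.1 he
      obtain ⟨b, rfl⟩ := List.mem_ofFn.1 hf
      exact hmeet a b) h1 h2 h3
    exact ⟨containsCircuit_of_not_nodup hnb.1 h4.1, containsCircuit_of_not_nodup hnb.2.1 h4.2⟩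

/-- A bound for the row and column sums of the matrix of weights of tangled paths of length `ℓ`, in
terms of the number `N` of circuits. -/
noncomputable def tangledBound (d ℓ : ℕ) (N : ℝ) : ℝ :=
  (ℓ + 1) ^ 2 * ((2 * d) ^ 2 * (4 * d) ^ ℓ) +
    2 * d * (4 * d) ^ ℓ * (ℓ * (4 * d) ^ ℓ * (N + ℓ ^ 2 * ((2 * d) ^ 2 * (4 * d) ^ ℓ)))

/-- Union bound over the times at which the pieces meet. -/
theorem indicator_piecesTangled_le {k L : ℕ} (η : Fin (k + 1) → HalfEdge n d)
    (θ : Fin (L + 1) → HalfEdge n d) :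
    (if PiecesTangled η θ then (1 : ℝ) else 0) ≤
      (∑ a, ∑ b, if (η a).1 = (θ b).1 then (1 : ℝ) else 0) +
        (if ContainsCircuit η then 1 else 0) * (if ContainsCircuit θ then 1 else 0) := by
  have h0 : ∀ a, 0 ≤ ∑ b, if (η a).1 = (θ b).1 then (1 : ℝ) else 0 :=
    fun a => Finset.sum_nonneg fun b _ => by positivity
  by_cases h : PiecesTangled η θ
  · rw [if_pos h]
    rcases h with ⟨a, b, h⟩ | ⟨h1, h2⟩
    · have h1 := Finset.single_le_sum (fun a _ => h0 a) (Finset.mem_univ a)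
      have h2 := Finset.single_le_sum (f := fun b => if (η a).1 = (θ b).1 then (1 : ℝ) else 0)
        (fun b _ => by positivity) (Finset.mem_univ b)
      simp only [if_pos h] at h2
      have h3 : (0 : ℝ) ≤ (if ContainsCircuit η then 1 else 0) *
        (if ContainsCircuit θ then 1 else 0) := by positivity
      linarith
    · rw [if_pos h1, if_pos h2, mul_one]
      exact le_add_of_nonneg_left (Finset.sum_nonneg fun a _ => h0 a)
  · rw [if_neg h]
    exact add_nonneg (Finset.sum_nonneg fun a _ => h0 a) (by positivity)

variable (σ : Fin d → Equiv.Perm (Fin n))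

/-- The weight of tangled paths, where `F` and `G` restrict the two pieces: `Y` bounds the paths
whose pieces meet at given times, `Z` those whose pieces both contain a circuit. -/
theorem sum_tangled_le {k L : ℕ} (F : (Fin (k + 1) → HalfEdge n d) → ℝ)
    (G : (Fin (L + 1) → HalfEdge n d) → ℝ) (hF : ∀ η, 0 ≤ F η) (hG : ∀ θ, 0 ≤ G θ) {Y Z : ℝ}
    (hY : ∀ a b, ∑ η, ∑ θ, pathWeight (majorant σ) η * pathWeight (majorant σ) θ *
      (F η * G θ * if (η a).1 = (θ b).1 then 1 else 0) ≤ Y)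
    (hZ : (∑ η, pathWeight (majorant σ) η * (F η * if ContainsCircuit η then 1 else 0)) *
      (∑ θ, pathWeight (majorant σ) θ * (G θ * if ContainsCircuit θ then 1 else 0)) ≤ Z) :
    ∑ γ : Fin (k + 1 + L + 1) → HalfEdge n d,
        pathWeight (majorant σ) (firstPiece γ) * pathWeight (majorant σ) (secondPiece γ) *
        ((if PiecesTangled (firstPiece γ) (secondPiece γ) then 1 else 0) *
          (F (firstPiece γ) * G (secondPiece γ))) ≤
      (k + 1) * (L + 1) * Y + Z := by
  have hw : ∀ {M : ℕ} (η : Fin (M + 1) → HalfEdge n d), 0 ≤ pathWeight (majorant σ) η :=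
    fun η => pathWeight_nonneg (majorant_nonneg σ) η
  rw [sum_pieces fun (η : Fin (k + 1) → HalfEdge n d) (θ : Fin (L + 1) → HalfEdge n d) =>
    pathWeight (majorant σ) η * pathWeight (majorant σ) θ *
      ((if PiecesTangled η θ then 1 else 0) * (F η * G θ))]
  have hpt : ∀ (η : Fin (k + 1) → HalfEdge n d) (θ : Fin (L + 1) → HalfEdge n d),
      pathWeight (majorant σ) η * pathWeight (majorant σ) θ *
        ((if PiecesTangled η θ then 1 else 0) * (F η * G θ)) ≤
      (∑ a : Fin (k + 1), ∑ b : Fin (L + 1), pathWeight (majorant σ) η * pathWeight (majorant σ) θ *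
        (F η * G θ * if (η a).1 = (θ b).1 then 1 else 0)) +
      pathWeight (majorant σ) η * (F η * if ContainsCircuit η then 1 else 0) *
        (pathWeight (majorant σ) θ * (G θ * if ContainsCircuit θ then 1 else 0)) := by
    intro η θ
    refine (mul_le_mul_of_nonneg_left (mul_le_mul_of_nonneg_right
      (indicator_piecesTangled_le η θ) (mul_nonneg (hF η) (hG θ)))
      (mul_nonneg (hw η) (hw θ))).trans (le_of_eq ?_)
    rw [add_mul, mul_add]
    congr 1
    · simp only [Finset.sum_mul, Finset.mul_sum]
      exact Finset.sum_congr rfl fun a _ => Finset.sum_congr rfl fun b _ => by ring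
    · ring
  refine (Finset.sum_le_sum fun η _ => Finset.sum_le_sum fun θ _ => hpt η θ).trans ?_
  simp only [Finset.sum_add_distrib]
  refine add_le_add ?_ ?_
  · have h1 : ∑ η : Fin (k + 1) → HalfEdge n d, ∑ θ : Fin (L + 1) → HalfEdge n d,
        ∑ a : Fin (k + 1), ∑ b : Fin (L + 1),
        pathWeight (majorant σ) η * pathWeight (majorant σ) θ *
        (F η * G θ * if (η a).1 = (θ b).1 then 1 else 0) =
        ∑ a : Fin (k + 1), ∑ b : Fin (L + 1),
        ∑ η : Fin (k + 1) → HalfEdge n d, ∑ θ : Fin (L + 1) → HalfEdge n d,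
        pathWeight (majorant σ) η * pathWeight (majorant σ) θ *
        (F η * G θ * if (η a).1 = (θ b).1 then 1 else 0) := by
      rw [Finset.sum_congr rfl fun η _ => Finset.sum_comm, Finset.sum_comm]
      refine Finset.sum_congr rfl fun a _ => ?_
      rw [Finset.sum_congr rfl fun η _ => Finset.sum_comm, Finset.sum_comm]
    rw [h1]
    refine (Finset.sum_le_sum fun a _ => Finset.sum_le_sum fun b _ => hY a b).trans_eq ?_
    simp only [Finset.sum_const, Finset.card_univ, Fintype.card_fin, nsmul_eq_mul]
    push_cast
    ring
  · refine le_trans (le_of_eq ?_) hZ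
    rw [Finset.sum_mul_sum]

theorem mul_meeting_bound_le (hd : 0 < d) {k L : ℕ} {a : ℝ} (ha : a ≤ 2 * d * (4 * d) ^ k) :
    a * (2 * d * (4 * d) ^ L) ≤ (2 * d) ^ 2 * (4 * d) ^ (k + 1 + L) := by
  have hd1 : (1 : ℝ) ≤ 4 * d := by
    have : (1 : ℝ) ≤ d := Nat.one_le_cast.2 hd
    linarith
  have h2 : (4 * d : ℝ) ^ (k + L) ≤ (4 * d) ^ (k + 1 + L) := pow_le_pow_right₀ hd1 (by omega)
  calc a * (2 * d * (4 * d) ^ L) ≤ 2 * d * (4 * d) ^ k * (2 * d * (4 * d) ^ L) := by gcongr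
    _ = (2 * d) ^ 2 * (4 * d) ^ (k + L) := by ring
    _ ≤ _ := by gcongr

theorem add_le_tangledBound {k L : ℕ} {Z N : ℝ}
    (hZ : Z ≤ 2 * d * (4 * d) ^ (k + 1 + L) * (((k + 1 + L : ℕ) : ℝ) * (4 * d) ^ (k + 1 + L) *
      (N + ((k + 1 + L : ℕ) : ℝ) ^ 2 * ((2 * d) ^ 2 * (4 * d) ^ (k + 1 + L))))) :
    (k + 1) * (L + 1) * ((2 * d) ^ 2 * (4 * d) ^ (k + 1 + L)) + Z ≤
      tangledBound d (k + 1 + L) N := by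
  refine add_le_add (mul_le_mul_of_nonneg_right ?_ (by positivity)) hZ
  push_cast
  have hk : (0 : ℝ) ≤ k := Nat.cast_nonneg k
  have hL : (0 : ℝ) ≤ L := Nat.cast_nonneg L
  nlinarith

theorem sum_mul_indicator_le {α : Type*} [Fintype α] {f g : α → ℝ} (hf : ∀ i, 0 ≤ f i)
    (hg : ∀ i, 0 ≤ g i) (p : α → Prop) :
    ∑ i, f i * (g i * if p i then 1 else 0) ≤ ∑ i, f i * g i := by
  refine Finset.sum_le_sum fun i _ => mul_le_mul_of_nonneg_left ?_ (hf i)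
  split_ifs
  · rw [mul_one]
  · rw [mul_zero]
    exact hg i

theorem sum_tangled_first_le (hn : 0 < n) (hd : 0 < d) {k L : ℕ} (x : Fin n) :
    ∑ γ : Fin (k + 1 + L + 1) → HalfEdge n d,
        pathWeight (majorant σ) (firstPiece γ) * pathWeight (majorant σ) (secondPiece γ) *
        ((if PiecesTangled (firstPiece γ) (secondPiece γ) then 1 else 0) *
          (if (γ 0).1 = x then 1 else 0)) ≤
      tangledBound d (k + 1 + L) (circuits σ (k + 1 + L)).card := by
  have hw : ∀ {M : ℕ} (η : Fin (M + 1) → HalfEdge n d), 0 ≤ pathWeight (majorant σ) η :=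
    fun η => pathWeight_nonneg (majorant_nonneg σ) η
  have hd1 : (1 : ℝ) ≤ 4 * d := by
    have : (1 : ℝ) ≤ d := Nat.one_le_cast.2 hd
    linarith
  set F : (Fin (k + 1) → HalfEdge n d) → ℝ := fun η => if (η 0).1 = x then 1 else 0 with hF
  have hF0 : ∀ η, 0 ≤ F η := fun η => by simp only [hF]; positivity
  have hF1 : ∑ η, pathWeight (majorant σ) η * F η ≤ 2 * d * (4 * d) ^ k :=
    sum_pathWeight_vertex_le σ 0 x
  have h := sum_tangled_le σ F (fun _ : Fin (L + 1) → HalfEdge n d => 1) hF0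
    (fun _ => zero_le_one) (Y := (2 * d) ^ 2 * (4 * d) ^ (k + 1 + L)) (fun a b => by
      simp only [mul_one]
      exact (sum_meeting_le σ a b F hF0).trans (mul_meeting_bound_le hd hF1)) le_rfl
  simp only [mul_one, one_mul] at h
  refine h.trans (add_le_tangledBound ?_)
  refine mul_le_mul (((sum_mul_indicator_le hw hF0 _).trans hF1).trans ?_)
    (sum_containsCircuit_weight_le σ hn hd (by omega))
    (Finset.sum_nonneg fun θ _ => mul_nonneg (hw θ) (by positivity)) (by positivity)
  exact mul_le_mul_of_nonneg_left (pow_le_pow_right₀ hd1 (by omega)) (by positivity)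

theorem sum_tangled_last_le (hn : 0 < n) (hd : 0 < d) {k L : ℕ} (y : Fin n) :
    ∑ γ : Fin (k + 1 + L + 1) → HalfEdge n d,
        pathWeight (majorant σ) (firstPiece γ) * pathWeight (majorant σ) (secondPiece γ) *
        ((if PiecesTangled (firstPiece γ) (secondPiece γ) then 1 else 0) *
          (if (γ (Fin.last (k + 1 + L))).1 = y then 1 else 0)) ≤
      tangledBound d (k + 1 + L) (circuits σ (k + 1 + L)).card := by
  have hw : ∀ {M : ℕ} (η : Fin (M + 1) → HalfEdge n d), 0 ≤ pathWeight (majorant σ) η :=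
    fun η => pathWeight_nonneg (majorant_nonneg σ) η
  have hd1 : (1 : ℝ) ≤ 4 * d := by
    have : (1 : ℝ) ≤ d := Nat.one_le_cast.2 hd
    linarith
  set G : (Fin (L + 1) → HalfEdge n d) → ℝ := fun θ => if (θ (Fin.last L)).1 = y then 1 else 0
    with hG
  have hG0 : ∀ θ, 0 ≤ G θ := fun θ => by simp only [hG]; positivity
  have hG1 : ∑ θ, pathWeight (majorant σ) θ * G θ ≤ 2 * d * (4 * d) ^ L :=
    sum_pathWeight_vertex_le σ (Fin.last L) y
  have h := sum_tangled_le σ (fun _ : Fin (k + 1) → HalfEdge n d => 1) G (fun _ => zero_le_one) hG0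
    (Y := (2 * d) ^ 2 * (4 * d) ^ (k + 1 + L)) (fun a b => by
      simp only [one_mul]
      refine (sum_meeting_le' σ a b G hG0).trans ((mul_meeting_bound_le hd hG1).trans_eq ?_)
      rw [show L + 1 + k = k + 1 + L by omega]) le_rfl
  simp only [one_mul] at h
  refine h.trans (add_le_tangledBound ?_)
  rw [mul_comm]
  refine mul_le_mul (((sum_mul_indicator_le hw hG0 _).trans hG1).trans ?_)
    (sum_containsCircuit_weight_le σ hn hd (by omega))
    (Finset.sum_nonneg fun θ _ => mul_nonneg (hw θ) (by positivity)) (by positivity)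
  exact mul_le_mul_of_nonneg_left (pow_le_pow_right₀ hd1 (by omega)) (by positivity)

end BadPaths

/-! ### Operator norms -/

section Operators

open Metric MeasureTheory

/-- Schur's test for operators on a finite `ℓ²`-direct sum: bounds for the row and column sums of a
matrix that dominates the blocks bound the operator norm. -/
theorem opNorm_le_of_row_col_sum_le {ι B : Type*} [Fintype ι] [NormedAddCommGroup B]
    [NormedSpace ℂ B] (T : PiLp 2 (fun _ : ι => B) →L[ℂ] PiLp 2 (fun _ : ι => B))
    (a : ι → ι → ℝ) (ha : ∀ x y, 0 ≤ a x y) {A : ℝ} (hA : 0 ≤ A)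
    (hT : ∀ v x, ‖(T v) x‖ ≤ ∑ y, a x y * ‖v y‖) (hrow : ∀ x, ∑ y, a x y ≤ A)
    (hcol : ∀ y, ∑ x, a x y ≤ A) : ‖T‖ ≤ A := by
  refine T.opNorm_le_bound hA fun v => ?_
  refine le_of_sq_le_sq ?_ (by positivity)
  rw [mul_pow, PiLp.norm_sq_eq_of_L2, PiLp.norm_sq_eq_of_L2]
  have h1 : ∀ x, ‖(T v) x‖ ^ 2 ≤ A * ∑ y, a x y * ‖v y‖ ^ 2 := by
    intro x
    have hpos : 0 ≤ ∑ y, a x y * ‖v y‖ ^ 2 :=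
      Finset.sum_nonneg fun y _ => mul_nonneg (ha x y) (by positivity)
    calc ‖(T v) x‖ ^ 2 ≤ (∑ y, a x y * ‖v y‖) ^ 2 := by gcongr; exact hT v x
      _ ≤ (∑ y, a x y) * ∑ y, a x y * ‖v y‖ ^ 2 :=
          Finset.sum_sq_le_sum_mul_sum_of_sq_le_mul _ (fun y _ => ha x y)
            (fun y _ => mul_nonneg (ha x y) (by positivity)) fun y _ => le_of_eq (by ring)
      _ ≤ _ := mul_le_mul_of_nonneg_right (hrow x) hpos
  calc ∑ x, ‖(T v) x‖ ^ 2 ≤ ∑ x, A * ∑ y, a x y * ‖v y‖ ^ 2 := Finset.sum_le_sum fun x _ => h1 x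
    _ = A * ∑ y, (∑ x, a x y) * ‖v y‖ ^ 2 := by
        rw [← Finset.mul_sum, Finset.sum_comm]
        simp only [Finset.sum_mul]
    _ ≤ A * ∑ y, A * ‖v y‖ ^ 2 := by
        gcongr with y
        exact hcol y
    _ = A ^ 2 * ∑ y, ‖v y‖ ^ 2 := by
        rw [← Finset.mul_sum]
        ring

variable {d : ℕ} (S : SchottkyData d)

theorem SchottkyData.norm_opA_le (i : Color d) (s : ℂ) {M : ℝ} (hM0 : 0 ≤ M)
    (hM : ∀ x ∈ S.discs \ S.disc i,
      ‖Complex.exp (-s * S.tau (mob (S.gen (bar i)) x))‖ ≤ M * ‖1 / S.den i x ^ 2‖) :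
    ‖S.opA i s‖ ≤ M :=
  ContinuousLinearMap.opNorm_le_bound _ hM0 fun f =>
    Bergman.norm_le_of_lintegral (f := f) (g := S.opA i s f) hM0 (S.lintegral_opFun_le i s hM f.val)

/-- The operators `A_i(s)` are bounded uniformly for `s` in a compact set: the weight of `A_i(s)`,
divided by the modulus of the derivative of `γ_ī`, is continuous in `(s, x)` up to the boundary of
the discs. -/
theorem SchottkyData.exists_norm_opA_le {K : Set ℂ} (hK : IsCompact K) :
    ∃ C : ℝ, 1 ≤ C ∧ ∀ s ∈ K, ∀ i, ‖S.opA i s‖ ≤ C := by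
  have hij : ∀ i j : Color d, ∃ M : ℝ, j ≠ i → ∀ s ∈ K, ∀ x ∈ S.disc j,
      ‖Complex.exp (-s * S.tau (mob (S.gen (bar i)) x))‖ ≤ M * ‖1 / S.den i x ^ 2‖ := by
    intro i j
    by_cases hij : j = i
    · exact ⟨0, fun h => absurd hij h⟩
    have hcont : ContinuousOn (fun p : ℂ × ℂ => Complex.exp (-p.1 * Complex.log (S.den i p.2 ^ 2))
        * S.den i p.2 ^ 2) (K ×ˢ closedBall (S.center j : ℂ) (S.radius j)) := by
      rintro ⟨s, y⟩ ⟨-, hy⟩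
      have hden : ContinuousAt (fun p : ℂ × ℂ => S.den i p.2) (s, y) := by
        unfold SchottkyData.den
        fun_prop
      have hlog : ContinuousAt (fun p : ℂ × ℂ => Complex.log (S.den i p.2 ^ 2)) (s, y) :=
        (hden.pow 2).clog (S.den_sq_mem hij hy)
      exact (((continuousAt_fst.neg.mul hlog).cexp).mul (hden.pow 2)).continuousWithinAt
    obtain ⟨M, hM⟩ := (hK.prod (isCompact_closedBall (S.center j : ℂ)
      (S.radius j))).exists_bound_of_continuousOn hcont
    refine ⟨M, fun _ s hs x hx => ?_⟩
    have hxc := ball_subset_closedBall hx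
    have h := hM (s, x) ⟨hs, hxc⟩
    have hd := (S.act_mem hij hxc).1
    have hpos : 0 < ‖S.den i x ^ 2‖ := norm_pos_iff.2 (pow_ne_zero 2 hd)
    rw [S.tau_mob hij hxc, norm_div, norm_one, mul_one_div, le_div_iff₀ hpos]
    rwa [norm_mul] at h
  choose M hM using hij
  refine ⟨1 + ∑ i, ∑ j, |M i j|, le_add_of_nonneg_right (by positivity), fun s hs i => ?_⟩
  refine S.norm_opA_le i s (by positivity) fun x hx => ?_
  obtain ⟨j, hji, hxj⟩ := S.exists_ne_of_mem hx
  refine (hM i j hji s hs x hxj).trans (mul_le_mul_of_nonneg_right ?_ (norm_nonneg _))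
  have h1 := Finset.single_le_sum (f := fun j => |M i j|) (fun _ _ => abs_nonneg _)
    (Finset.mem_univ j)
  have h2 := Finset.single_le_sum (f := fun i => ∑ j, |M i j|)
    (fun i _ => Finset.sum_nonneg fun _ _ => abs_nonneg _) (Finset.mem_univ i)
  have h3 := le_abs_self (M i j)
  linarith

theorem SchottkyData.norm_wordOp_le {s : ℂ} {C : ℝ} (hC : 1 ≤ C) (h : ∀ i, ‖S.opA i s‖ ≤ C)
    (w : List (Color d)) : ‖S.wordOp s w‖ ≤ C ^ w.length := by
  induction w with
  | nil =>
    simp only [SchottkyData.wordOp, List.map_nil, List.prod_nil, List.length_nil, pow_zero]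
    exact ContinuousLinearMap.norm_id_le
  | cons i w ih =>
    rw [SchottkyData.wordOp, List.map_cons, List.prod_cons, List.length_cons, pow_succ']
    exact (ContinuousLinearMap.opNorm_comp_le (S.opA i s) (S.wordOp s w)).trans
      (mul_le_mul (h i) ih (norm_nonneg _) (by positivity))

theorem SchottkyData.norm_discProj_apply_le (i : Color d) (f : S.Bergman) :
    ‖S.discProj i f‖ ≤ ‖f‖ := by
  have h := Bergman.norm_le_of_lintegral (f := f) (g := S.discProj i f) zero_le_one (by
    rw [one_pow, ENNReal.ofReal_one, one_mul]
    refine lintegral_mono fun z => ENNReal.ofReal_le_ofReal ?_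
    rw [S.discProj_val]
    have := norm_indicator_le_norm_self f.val (s := S.disc i) z
    gcongr)
  rwa [one_mul] at h

theorem SchottkyData.tensorE_apply {n : ℕ} (A : S.Bergman →L[ℂ] S.Bergman) (x y z : Fin n)
    (v : S.Space n) : (S.tensorE A x y v) z = if z = x then A (v y) else 0 := by
  change (PiLp.single 2 x (A (v y)) : S.Space n) z = _
  by_cases h : z = x
  · subst h
    simp
  · simp [h]

theorem SchottkyData.norm_edge_tensorE_edge_le {n : ℕ} (A : S.Bergman →L[ℂ] S.Bergman)
    (e f : HalfEdge n d) (v : S.Space n) (z : Fin n) :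
    ‖((S.edgeProj e ∘L S.tensorE A e.1 f.1 ∘L S.edgeProj f) v) z‖ ≤
      if e.1 = z then ‖A‖ * ‖v f.1‖ else 0 := by
  simp only [ContinuousLinearMap.comp_apply, SchottkyData.edgeProj, S.tensorE_apply, if_true]
  by_cases h : z = e.1
  · rw [if_pos h, if_pos h.symm]
    refine (S.norm_discProj_apply_le _ _).trans ((A.le_opNorm _).trans ?_)
    exact mul_le_mul_of_nonneg_left (S.norm_discProj_apply_le _ _) (norm_nonneg _)
  · rw [if_neg h, if_neg (Ne.symm h), norm_zero]

open Classical in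
/-- The operator norm of the remainder is bounded in terms of the number of circuits, through the
absolute values of the weights. -/
theorem SchottkyData.norm_remainder_le {s : ℂ} {C : ℝ} (hC : 1 ≤ C) (h : ∀ i, ‖S.opA i s‖ ≤ C)
    {n k ℓ : ℕ} (hn : 0 < n) (hd : 0 < d) (hk : 1 ≤ k) (hkℓ : k ≤ ℓ)
    (σ : Fin d → Equiv.Perm (Fin n)) :
    ‖S.remainder n ℓ k s σ‖ ≤ C ^ ℓ * tangledBound d ℓ (circuits σ ℓ).card := by
  obtain ⟨k, rfl⟩ : ∃ k', k = k' + 1 := ⟨k - 1, by omega⟩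
  obtain ⟨L, rfl⟩ : ∃ L, ℓ = k + 1 + L := ⟨ℓ - (k + 1), by omega⟩
  set W : (Fin (k + 1 + L + 1) → HalfEdge n d) → ℝ := fun γ =>
    pathWeight (majorant σ) (firstPiece γ) * pathWeight (majorant σ) (secondPiece γ) *
      (if PiecesTangled (firstPiece γ) (secondPiece γ) then 1 else 0) with hW
  have hC0 : 0 ≤ C := zero_le_one.trans hC
  have hW0 : ∀ γ, 0 ≤ W γ := fun γ => mul_nonneg (mul_nonneg
    (pathWeight_nonneg (majorant_nonneg σ) _) (pathWeight_nonneg (majorant_nonneg σ) _))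
    (by positivity)
  have hcoeff : ∀ γ : Fin (k + 1 + L + 1) → HalfEdge n d,
      ‖(∏ t : Fin (k + 1 + L) with t.val + 1 < k + 1,
        permEntryCentered σ (γ t.castSucc).2 (γ t.castSucc).1 (γ t.succ).1) *
      ∏ t : Fin (k + 1 + L) with k + 1 ≤ t.val,
        permEntry σ (γ t.castSucc).2 (γ t.castSucc).1 (γ t.succ).1‖ ≤
      pathWeight (majorant σ) (firstPiece γ) * pathWeight (majorant σ) (secondPiece γ) := by
    intro γ
    rw [norm_mul, norm_prod, norm_prod, ← prod_filter_lt_eq_pathWeight,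
      ← prod_filter_ge_eq_pathWeight]
    refine mul_le_mul
      (Finset.prod_le_prod (fun _ _ => norm_nonneg _) fun t _ => norm_permEntryCentered_le σ _ _)
      (Finset.prod_le_prod (fun _ _ => norm_nonneg _) fun t _ => norm_permEntry_le σ _ _)
      (Finset.prod_nonneg fun _ _ => norm_nonneg _)
      (Finset.prod_nonneg fun _ _ => majorant_nonneg σ _ _)
  have hA0 : 0 ≤ tangledBound d (k + 1 + L) (circuits σ (k + 1 + L)).card := by
    unfold tangledBound
    positivity
  refine opNorm_le_of_row_col_sum_le _ (fun x y => ∑ γ, C ^ (k + 1 + L) * (W γ *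
    ((if (γ 0).1 = x then 1 else 0) * (if (γ (Fin.last (k + 1 + L))).1 = y then 1 else 0))))
    (fun x y => Finset.sum_nonneg fun γ _ => mul_nonneg (by positivity)
      (mul_nonneg (hW0 γ) (by positivity))) (by positivity) ?_ ?_ ?_
  · intro v x
    have hterm : ∀ γ : Fin (k + 1 + L + 1) → HalfEdge n d,
        MemFk (k + 1) (List.ofFn γ) ∧ ¬ MemF (List.ofFn γ) →
        ‖((((∏ t : Fin (k + 1 + L) with t.val + 1 < k + 1,
            permEntryCentered σ (γ t.castSucc).2 (γ t.castSucc).1 (γ t.succ).1) *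
          ∏ t : Fin (k + 1 + L) with k + 1 ≤ t.val,
            permEntry σ (γ t.castSucc).2 (γ t.castSucc).1 (γ t.succ).1) •
          (S.edgeProj (γ 0) ∘L
            S.tensorE (S.wordOp s ((List.ofFn γ).tail.map Prod.snd)) (γ 0).1
              (γ (Fin.last (k + 1 + L))).1 ∘L
            S.edgeProj (γ (Fin.last (k + 1 + L))))) v) x‖ ≤
        C ^ (k + 1 + L) * (W γ * (if (γ 0).1 = x then 1 else 0)) *
          ‖v (γ (Fin.last (k + 1 + L))).1‖ := by
      intro γ hγ
      rw [_root_.smul_apply, PiLp.smul_apply, norm_smul]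
      have h1 := S.norm_edge_tensorE_edge_le
        (S.wordOp s ((List.ofFn γ).tail.map Prod.snd)) (γ 0) (γ (Fin.last (k + 1 + L))) v x
      have h2 := S.norm_wordOp_le hC h ((List.ofFn γ).tail.map Prod.snd)
      rw [List.length_map, List.length_tail, List.length_ofFn, Nat.add_sub_cancel] at h2
      have h3 : W γ = pathWeight (majorant σ) (firstPiece γ) *
          pathWeight (majorant σ) (secondPiece γ) := by
        simp only [hW]
        rw [if_pos (piecesTangled_of_memFk hγ.1 hγ.2), mul_one]
      have h4 := hcoeff γ
      rw [← h3] at h4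
      refine (mul_le_mul h4 h1 (norm_nonneg _) (hW0 γ)).trans ?_
      split_ifs
      · calc W γ * (‖S.wordOp s ((List.ofFn γ).tail.map Prod.snd)‖ *
              ‖v (γ (Fin.last (k + 1 + L))).1‖)
            ≤ W γ * (C ^ (k + 1 + L) * ‖v (γ (Fin.last (k + 1 + L))).1‖) :=
              mul_le_mul_of_nonneg_left (mul_le_mul_of_nonneg_right h2 (norm_nonneg _)) (hW0 γ)
          _ = _ := by ring
      · simp
    have hsum : ∀ γ : Fin (k + 1 + L + 1) → HalfEdge n d,
        ∑ y, C ^ (k + 1 + L) * (W γ * ((if (γ 0).1 = x then 1 else 0) *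
          (if (γ (Fin.last (k + 1 + L))).1 = y then 1 else 0))) * ‖v y‖ =
        C ^ (k + 1 + L) * (W γ * (if (γ 0).1 = x then 1 else 0)) *
          ‖v (γ (Fin.last (k + 1 + L))).1‖ := by
      intro γ
      rw [Finset.sum_eq_single (γ (Fin.last (k + 1 + L))).1]
      · rw [if_pos rfl, mul_one]
      · intro y _ hy
        rw [if_neg hy.symm]
        simp
      · simp
    simp only [Finset.sum_mul]
    rw [Finset.sum_comm, Finset.sum_congr rfl fun γ _ => hsum γ, SchottkyData.remainder,
      _root_.sum_apply, WithLp.ofLp_sum, Finset.sum_apply]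
    refine (norm_sum_le _ _).trans ((Finset.sum_le_sum fun γ hγ =>
      hterm γ (Finset.mem_filter.1 hγ).2).trans ?_)
    exact Finset.sum_le_sum_of_subset_of_nonneg (Finset.subset_univ _) fun γ _ _ =>
      mul_nonneg (mul_nonneg (by positivity) (mul_nonneg (hW0 γ) (by positivity))) (norm_nonneg _)
  · intro x
    rw [Finset.sum_comm]
    simp only [← Finset.mul_sum, Finset.sum_ite_eq, Finset.mem_univ, if_true, mul_one]
    refine mul_le_mul_of_nonneg_left (le_trans (le_of_eq ?_) (sum_tangled_first_le σ hn hd x))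
      (by positivity)
    exact Finset.sum_congr rfl fun γ _ => by simp only [hW]; ring
  · intro y
    rw [Finset.sum_comm]
    simp only [← Finset.mul_sum, ← Finset.sum_mul, Finset.sum_ite_eq, Finset.mem_univ, if_true,
      one_mul]
    refine mul_le_mul_of_nonneg_left (le_trans (le_of_eq ?_) (sum_tangled_last_le σ hn hd y))
      (by positivity)
    exact Finset.sum_congr rfl fun γ _ => by simp only [hW]; ring

end Operators

/-! ### The tail bound -/

section Numerics

theorem natCast_succ_le_pow {b : ℝ} (hb : 2 ≤ b) (ℓ : ℕ) : (ℓ : ℝ) + 1 ≤ b ^ ℓ := by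
  have h1 : ((ℓ + 1 : ℕ) : ℝ) ≤ ((2 ^ ℓ : ℕ) : ℝ) := Nat.cast_le.2 Nat.lt_two_pow_self
  push_cast at h1
  exact h1.trans (pow_le_pow_left₀ (by norm_num) hb ℓ)

/-- All polynomial factors in `ℓ` and all constants are absorbed in a power of `(4d) ^ ℓ`. -/
theorem tangledBound_circuitThreshold_le {d ℓ m : ℕ} {lam : ℝ} (hd : 2 ≤ d) (hℓ : 1 ≤ ℓ)
    (hlam : 1 ≤ lam) (hm : (m : ℝ) ≤ 2 * (ℓ * lam)) :
    tangledBound d ℓ (circuitThreshold d ℓ m) ≤ lam * ((4 * d : ℝ) ^ 14) ^ ℓ := by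
  have hd8 : (8 : ℝ) ≤ 4 * d := by
    have : (2 : ℝ) ≤ d := by exact_mod_cast hd
    linarith
  set B : ℝ := (4 * d) ^ ℓ with hB
  have hB1 : (4 * d : ℝ) ≤ B := le_self_pow₀ (by linarith) (by omega)
  have hB8 : 8 ≤ B := hd8.trans hB1
  have hd2 : (2 * d : ℝ) ≤ B := by linarith
  have hℓB : (ℓ : ℝ) + 1 ≤ B := natCast_succ_le_pow (by linarith) ℓ
  have hℓB' : (ℓ : ℝ) ≤ B := by linarith
  have hB0 : 0 ≤ B := by linarith
  have hq : 2 * d * B ≤ B ^ 2 := by nlinarith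
  have hmB : (m : ℝ) ≤ B ^ 2 * lam := by
    have : 2 * (ℓ : ℝ) ≤ B ^ 2 := by nlinarith
    nlinarith
  have hpow : ∀ a b : ℕ, a ≤ b → B ^ a ≤ B ^ b := fun a b h => pow_le_pow_right₀ (by linarith) h
  have hT : ((circuitThreshold d ℓ m : ℕ) : ℝ) ≤ B ^ 8 * lam := by
    rw [circuitThreshold]
    push_cast
    rw [← hB]
    calc 3 * ((ℓ : ℝ) * (2 * d * B)) + m * (ℓ + 1) * (ℓ * ((ℓ + 1) * (2 * d * B)))
        ≤ B * (B * B ^ 2) + B ^ 2 * lam * B * (B * (B * B ^ 2)) := by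
          have h3 : (3 : ℝ) ≤ B := by linarith
          gcongr
      _ = B ^ 4 * 1 + B ^ 7 * lam := by ring
      _ ≤ B ^ 7 * lam + B ^ 7 * lam := by
          have := hpow 4 7 (by norm_num)
          gcongr
      _ = 2 * (B ^ 7 * lam) := by ring
      _ ≤ B * (B ^ 7 * lam) := by
          gcongr
          linarith
      _ = _ := by ring
  have hd4 : (2 * d : ℝ) ^ 2 ≤ B ^ 2 := by gcongr
  rw [tangledBound, ← hB]
  calc ((ℓ : ℝ) + 1) ^ 2 * ((2 * d) ^ 2 * B) +
        2 * d * B * (ℓ * B * (((circuitThreshold d ℓ m : ℕ) : ℝ) + ℓ ^ 2 * ((2 * d) ^ 2 * B)))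
      ≤ B ^ 2 * (B ^ 2 * B) + B ^ 2 * (B * B * (B ^ 8 * lam + B ^ 2 * (B ^ 2 * B))) := by
        gcongr
    _ = B ^ 5 * 1 + B ^ 12 * lam + B ^ 9 * 1 := by ring
    _ ≤ B ^ 12 * lam + B ^ 12 * lam + B ^ 12 * lam := by
        have h1 := hpow 5 12 (by norm_num)
        have h2 := hpow 9 12 (by norm_num)
        gcongr
    _ = 3 * (B ^ 12 * lam) := by ring
    _ ≤ B ^ 2 * (B ^ 12 * lam) := by
        gcongr
        nlinarith
    _ = lam * B ^ 14 := by ring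
    _ = _ := by rw [hB, ← pow_mul, ← pow_mul, mul_comm ℓ 14]

theorem three_le_of_one_le_log {n : ℕ} (h : 1 ≤ Real.log n) : 3 ≤ n := by
  by_contra! hn
  have h2 : Real.log n ≤ Real.log 2 := by
    rcases Nat.eq_zero_or_pos n with rfl | hpos
    · simp [Real.log_nonneg]
    · exact Real.log_le_log (Nat.cast_pos.2 hpos) (by exact_mod_cast (by omega : n ≤ 2))
  have := Real.log_two_lt_d9
  linarith

theorem one_le_hundred_mul_log_log {n : ℕ} (hn : 3 ≤ n) :
    1 ≤ 100 * Real.log (Real.log n) := by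
  have h1 : Real.log 3 ≤ Real.log n := Real.log_le_log (by norm_num) (by exact_mod_cast hn)
  have h2 : (1.09 : ℝ) ≤ Real.log 3 := by
    have h3 := Real.one_sub_inv_le_log_of_pos (x := 3 / Real.exp 1) (by positivity)
    rw [Real.log_div (by norm_num) (Real.exp_pos 1).ne', Real.log_exp, inv_div] at h3
    have := Real.exp_one_lt_d9
    linarith
  have h4 : (1.09 : ℝ) ≤ Real.log n := h2.trans h1
  have h5 := Real.one_sub_inv_le_log_of_pos (x := Real.log n) (by linarith)
  have h6 : (Real.log n)⁻¹ ≤ (1.09 : ℝ)⁻¹ := inv_anti₀ (by norm_num) h4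
  norm_num at h6
  linarith

theorem inv_three_pow_le_exp {x : ℝ} {m : ℕ} (h : x ≤ m) : 1 / (3 : ℝ) ^ m ≤ Real.exp (-x) := by
  have h1 : Real.exp 1 ≤ 3 := by
    have := Real.exp_one_lt_d9
    linarith
  have h2 : Real.exp x ≤ 3 ^ m := by
    calc Real.exp x ≤ Real.exp m := Real.exp_le_exp.2 h
      _ = Real.exp 1 ^ m := by rw [← Real.exp_nat_mul, mul_one]
      _ ≤ 3 ^ m := pow_le_pow_left₀ (Real.exp_pos 1).le h1 m
  rw [Real.exp_neg, one_div]
  exact inv_anti₀ (Real.exp_pos x) h2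

end Numerics

section Tail

variable {n d : ℕ}

theorem prob_eq (P : (Fin d → Equiv.Perm (Fin n)) → Prop) [DecidablePred P] :
    prob n d P = ((Finset.univ.filter P).card : ℝ) /
      (Fintype.card (Fin d → Equiv.Perm (Fin n)) : ℝ) := by
  unfold prob
  congr!

open Classical

theorem prob_mono {P Q : (Fin d → Equiv.Perm (Fin n)) → Prop} (h : ∀ σ, P σ → Q σ) :
    prob n d P ≤ prob n d Q := by
  unfold prob
  gcongr with σ
  exact h σ

theorem prob_not (P : (Fin d → Equiv.Perm (Fin n)) → Prop) :
    prob n d (fun σ => ¬ P σ) = 1 - prob n d P := by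
  have hpos : (0 : ℝ) < Fintype.card (Fin d → Equiv.Perm (Fin n)) :=
    Nat.cast_pos.2 Fintype.card_pos
  have h : ((Finset.univ.filter P).card : ℝ) + (Finset.univ.filter fun σ => ¬ P σ).card =
      Fintype.card (Fin d → Equiv.Perm (Fin n)) := by
    exact_mod_cast Finset.card_filter_add_card_filter_not (s := Finset.univ) P
  rw [prob_eq P, prob_eq fun σ => ¬ P σ, eq_sub_iff_add_eq, ← add_div, add_comm, h, div_self
hpos.ne']

/-- With probability at least `1 - 3 ^ (-m)`, the number of circuits of length at most `ℓ` is below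
the threshold. If `m ℓ` exceeds `n / 2`, this holds always, because there are few vertices to start
from. -/
theorem one_sub_le_prob_circuits_le (hn : 0 < n) (hd : 0 < d) {ℓ : ℕ} (hℓ : 0 < ℓ) (m : ℕ) :
    1 - 1 / (3 : ℝ) ^ m ≤
      prob n d fun σ => (circuits σ ℓ).card ≤ circuitThreshold d ℓ m := by
  by_cases hm : 2 * (m * ℓ) ≤ n
  · have h1 := card_many_circuits_le (n := n) hn hd hℓ hm
    have hpos : (0 : ℝ) < Fintype.card (Fin d → Equiv.Perm (Fin n)) :=
      Nat.cast_pos.2 Fintype.card_pos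
    have h2 : prob n d (fun σ => circuitThreshold d ℓ m ≤ (circuits σ ℓ).card) ≤ 1 / 3 ^ m := by
      rw [prob_eq, div_le_div_iff₀ hpos (by positivity), one_mul]
      exact h1
    have h3 := prob_not (n := n) (d := d)
      fun σ => circuitThreshold d ℓ m ≤ (circuits σ ℓ).card
    have h4 := prob_mono (n := n) (d := d)
      (P := fun σ => ¬ circuitThreshold d ℓ m ≤ (circuits σ ℓ).card)
      (Q := fun σ => (circuits σ ℓ).card ≤ circuitThreshold d ℓ m) fun σ h => (not_le.1 h).le
    linarith
  · have h1 : ∀ σ : Fin d → Equiv.Perm (Fin n), (circuits σ ℓ).card ≤ circuitThreshold d ℓ m := by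
      intro σ
      refine (card_circuits_le σ hd ℓ).trans ?_
      rw [circuitThreshold]
      refine le_trans ?_ (Nat.le_add_left _ _)
      rw [mul_assoc m, ← mul_assoc (ℓ + 1), ← mul_assoc m]
      have h2 : n ≤ m * (2 * ℓ) := by
        have : m * (2 * ℓ) = 2 * (m * ℓ) := by ring
        omega
      calc n * (ℓ * (2 * d * (4 * d) ^ ℓ)) ≤ m * (2 * ℓ) * (ℓ * (2 * d * (4 * d) ^ ℓ)) :=
            Nat.mul_le_mul_right _ h2
        _ ≤ m * ((ℓ + 1) * (ℓ + 1)) * (ℓ * (2 * d * (4 * d) ^ ℓ)) := by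
          refine Nat.mul_le_mul_right _ (Nat.mul_le_mul_left _ ?_)
          nlinarith
        _ = _ := by ring
    have h2 : prob n d (fun σ => (circuits σ ℓ).card ≤ circuitThreshold d ℓ m) = 1 := by
      rw [prob_eq, Finset.filter_true_of_mem fun σ _ => h1 σ, Finset.card_univ, div_self]
      exact (Nat.cast_pos.2 Fintype.card_pos).ne'
    rw [h2]
    have : (0 : ℝ) ≤ 1 / 3 ^ m := by positivity
    linarith

end Tail

end Schottky

theorem mainTheorem5 {d : ℕ} (hd : 2 ≤ d) (S : Schottky.SchottkyData d) (K : Set ℂ)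
    (hK : IsCompact K) (hKδ : K ⊆ {s : ℂ | S.delta / 2 < s.re}) :
    ∃ c ρ₁ : ℝ, 0 < c ∧ 1 < ρ₁ ∧
      ∀ s ∈ K, ∀ n k ℓ : ℕ, 1 ≤ k → k ≤ ℓ → (ℓ : ℝ) ≤ Real.log n →
        1 - c * Real.exp (-((ℓ * Real.log n) / (c * Real.log (Real.log n)))) ≤
          Schottky.prob n d fun σ =>
            ‖S.remainder n ℓ k s σ‖ ≤ (Real.log n) ^ 40 * ρ₁ ^ ℓ := by
  obtain ⟨C, hC1, hC⟩ := S.exists_norm_opA_le hK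
  have hd8 : (8 : ℝ) ≤ 4 * d := by
    have : (2 : ℝ) ≤ d := by exact_mod_cast hd
    linarith
  have hpow : (1 : ℝ) < (4 * d) ^ 14 := one_lt_pow₀ (by linarith) (by norm_num)
  -- The factor `100` makes `c * log (log n)` at least `1`, as `log (log n)` is small for `n = 3`.
  refine ⟨100, C * (4 * d) ^ 14, by norm_num, by nlinarith, fun s hs n k ℓ hk hkℓ hℓn => ?_⟩
  have hℓ : 1 ≤ ℓ := hk.trans hkℓ
  have hlam : 1 ≤ Real.log n := le_trans (by exact_mod_cast hℓ) hℓn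
  -- The cases `n < 3`, in which `log (log n)` is negative or a junk value, do not occur.
  have hn3 := Schottky.three_le_of_one_le_log hlam
  have hℓlam : 1 ≤ (ℓ : ℝ) * Real.log n :=
    one_le_mul_of_one_le_of_one_le (by exact_mod_cast hℓ) hlam
  set m : ℕ := ⌈(ℓ : ℝ) * Real.log n⌉₊ with hm
  have hm1 : (ℓ : ℝ) * Real.log n ≤ m := Nat.le_ceil _
  have hm2 : (m : ℝ) ≤ 2 * (ℓ * Real.log n) := by
    have := Nat.ceil_lt_add_one (zero_le_one.trans hℓlam)
    linarith
  have hexp : 1 / (3 : ℝ) ^ m ≤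
      100 * Real.exp (-((ℓ * Real.log n) / (100 * Real.log (Real.log n)))) := by
    have h1 : (ℓ * Real.log n) / (100 * Real.log (Real.log n)) ≤ m :=
      (div_le_self (by positivity) (Schottky.one_le_hundred_mul_log_log hn3)).trans hm1
    have h2 := Schottky.inv_three_pow_le_exp h1
    have h3 := Real.exp_pos (-((ℓ * Real.log n) / (100 * Real.log (Real.log n))))
    linarith
  have htail := Schottky.one_sub_le_prob_circuits_le (n := n) (d := d) (by omega) (by omega)
    (ℓ := ℓ) hℓ m
  refine le_trans (by linarith) (htail.trans (Schottky.prob_mono fun σ hσ => ?_))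
  refine (S.norm_remainder_le hC1 (hC s hs) (by omega) (by omega) hk hkℓ σ).trans ?_
  have h1 : Schottky.tangledBound d ℓ (Schottky.circuits σ ℓ).card ≤
      Schottky.tangledBound d ℓ (Schottky.circuitThreshold d ℓ m) := by
    unfold Schottky.tangledBound
    have : ((Schottky.circuits σ ℓ).card : ℝ) ≤ Schottky.circuitThreshold d ℓ m :=
      Nat.cast_le.2 hσ
    gcongr
  have h2 := Schottky.tangledBound_circuitThreshold_le hd hℓ hlam hm2
  calc C ^ ℓ * Schottky.tangledBound d ℓ (Schottky.circuits σ ℓ).card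
      ≤ C ^ ℓ * (Real.log n * ((4 * d : ℝ) ^ 14) ^ ℓ) := by
        gcongr
        exact h1.trans h2
    _ = Real.log n * (C * (4 * d) ^ 14) ^ ℓ := by rw [mul_pow C]; ring
    _ ≤ (Real.log n) ^ 40 * (C * (4 * d) ^ 14) ^ ℓ := by
        gcongr
        exact le_self_pow₀ hlam (by norm_num)
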